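/- Consider a smooth pure exchange economy with two consumers and $L\ge 1$ goods. Consumer $i\in\{1,2\}$ has consumption space $\mathbb R^L$ and a utility function $u_i:\mathbb R^L\to\mathbb R$ that is $C^\infty$, has strictly positive partial derivatives everywhere, satisfies $D^2u_i(x)(h,h)<0$ for all $x$ and all $h\neq 0$ with $Du_i(x)h=0$, and whose indifference surfaces $\{y : u_i(y)=u_i(x)\}$ are all bounded from below. Let $S=\{p\in\mathbb R^L : p_l>0 \text{ for all } l,\ p_L=1\}$ be the set of normalized prices, fix total resources $r\in\mathbb R^L$, and let $\Omega(r)=\{(\omega_1,\omega_2)\in\mathbb R^L\times\mathbb R^L : \omega_1+\omega_2=r\}$. A price $p\in S$ is an equilibrium price for $\omega=(\omega_1,\omega_2)\in\Omega(r)$ if there are $x_1,x_2\in\mathbb R^L$ with $x_1+x_2=\omega_1+\omega_2$ such that $x_i$ maximizes $u_i$ over $\{y : p\cdot y\le p\cdot\omega_i\}$ for $i=1,2$. Let $E(r)$ be the set of all $(p,\omega)\in S\times\Omega(r)$ such that $p$ is an equilibrium price for $\omega$, regarded as a subset of $\mathbb R^{2L-1}$ through the coordinates $(p_1,\dots,p_{L-1},\omega_1)$.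 Then $E(r)$ is a smooth embedded $L$-dimensional submanifold of $\mathbb R^{2L-1}$, and, for the Riemannian metric induced on it by the Euclidean metric of $\mathbb R^{2L-1}$, the following are equivalent: 1. every $\omega\in\Omega(r)$ has exactly one equilibrium price $p\in S$; 2. all sectional curvatures of $E(r)$ are zero (at every point and for every tangent plane). -/

import Mathlib

noncomputable section

/-! ## Riemannian geometry of embedded submanifolds, in local coordinates -/

namespace Embedded

variable {m : ℕ} {V : Type*} [NormedAddCommGroup V] [InnerProductSpace ℝ V]

/-- The partial derivative of `f` with respect to the `i`-th coordinate. -/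
def partialDeriv {F : Type*} [NormedAddCommGroup F] [NormedSpace ℝ F]
    (i : Fin m) (f : (Fin m → ℝ) → F) (x : Fin m → ℝ) : F :=
  fderiv ℝ f x (Pi.single i 1)

/-- `Φ : U → E` is a smooth local parametrization of the `m`-dimensional submanifold `E` of `V`:
`U` is open in `ℝᵐ`, `Φ` is a smooth immersion on `U` with values in `E`, and it is a homeomorphism
from `U` onto a relatively open subset of `E`. -/
structure IsLocalParam (E : Set V) (U : Set (Fin m → ℝ)) (Φ : (Fin m → ℝ) → V) : Prop where
  isOpen : IsOpen U
  smooth : ContDiffOn ℝ (⊤ : ℕ∞) Φ U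
  immersion : ∀ x ∈ U, Function.Injective (fderiv ℝ Φ x)
  embedding : ∃ h : Set.MapsTo Φ U E, Topology.IsOpenEmbedding (h.restrict Φ U E)

/-- `E` is a smooth (embedded) submanifold of `V` of dimension `m`: every point of `E` lies in the
image of a smooth local parametrization. -/
def IsSmoothSubmanifold (m : ℕ) (E : Set V) : Prop :=
  ∀ z ∈ E, ∃ (U : Set (Fin m → ℝ)) (Φ : (Fin m → ℝ) → V), IsLocalParam E U Φ ∧ z ∈ Φ '' U

/-- The coefficients `g_ij = ⟨X_i, X_j⟩` of the induced metric, where `X_i = ∂Φ/∂x_i`. -/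
def metric (Φ : (Fin m → ℝ) → V) (x : Fin m → ℝ) : Matrix (Fin m) (Fin m) ℝ :=
  Matrix.of fun i j => inner ℝ (partialDeriv i Φ x) (partialDeriv j Φ x)

/-- The Christoffel symbols
`Γ_ij^k = 1/2 ∑_h g^hk (∂g_jh/∂x_i + ∂g_hi/∂x_j - ∂g_ij/∂x_h)` of the induced metric. -/
def christoffel (Φ : (Fin m → ℝ) → V) (i j k : Fin m) (x : Fin m → ℝ) : ℝ :=
  (1 / 2 : ℝ) * ∑ h, (metric Φ x)⁻¹ h k *
    (partialDeriv i (fun y => metric Φ y j h) x + partialDeriv j (fun y => metric Φ y h i) x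
      - partialDeriv h (fun y => metric Φ y i j) x)

/-- The coefficients `R_ijk^s` of the curvature tensor, `R(X_i, X_j) X_k = ∑_s R_ijk^s X_s`, with
the sign convention `R(X, Y) Z = ∇_Y ∇_X Z - ∇_X ∇_Y Z + ∇_[X,Y] Z`. -/
def riemann (Φ : (Fin m → ℝ) → V) (i j k s : Fin m) (x : Fin m → ℝ) : ℝ :=
  ∑ l, christoffel Φ i k l x * christoffel Φ j l s x
    - ∑ l, christoffel Φ j k l x * christoffel Φ i l s x
    + partialDeriv j (christoffel Φ i k s) x - partialDeriv i (christoffel Φ j k s) x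

/-- The inner product `⟨X, Y⟩` of the tangent vectors `X = ∑ a_i X_i`, `Y = ∑ b_j X_j`. -/
def metricForm (Φ : (Fin m → ℝ) → V) (x a b : Fin m → ℝ) : ℝ :=
  ∑ i, ∑ j, a i * b j * metric Φ x i j

/-- `⟨R(X, Y) X, Y⟩` for the tangent vectors `X = ∑ a_i X_i`, `Y = ∑ b_j X_j`, computed from
`⟨R(X_i, X_j) X_k, X_s⟩ = ∑_l R_ijk^l g_ls`. -/
def curvatureForm (Φ : (Fin m → ℝ) → V) (x a b : Fin m → ℝ) : ℝ :=
  ∑ i, ∑ j, ∑ k, ∑ s, a i * b j * a k * b s * ∑ l, riemann Φ i j k l x * metric Φ x l s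

/-- The sectional curvature `K(X, Y) = ⟨R(X, Y) X, Y⟩ / (|X|² |Y|² - ⟨X, Y⟩²)` of the plane spanned
by the tangent vectors `X = ∑ a_i X_i`, `Y = ∑ b_j X_j` at the point `Φ x`. -/
def sectionalCurvature (Φ : (Fin m → ℝ) → V) (x a b : Fin m → ℝ) : ℝ :=
  curvatureForm Φ x a b /
    (metricForm Φ x a a * metricForm Φ x b b - metricForm Φ x a b ^ 2)

/-- All sectional curvatures of the `m`-dimensional submanifold `E` of `V`, with the metric induced
by `V`, vanish: at every point and for every tangent plane, in every local parametrization. -/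
def HasZeroCurvature (m : ℕ) (E : Set V) : Prop :=
  ∀ (U : Set (Fin m → ℝ)) (Φ : (Fin m → ℝ) → V), IsLocalParam E U Φ →
    ∀ x ∈ U, ∀ a b : Fin m → ℝ, LinearIndependent ℝ ![a, b] → sectionalCurvature Φ x a b = 0

end Embedded

/-! ## Smooth pure exchange economies with `n + 1` goods

The last good is the numéraire. -/

namespace Exchange

variable {n M : ℕ}

/-- Standard assumptions on the utility function of a consumer in a smooth exchange economy with
consumption space `ℝ^(n+1)`: smoothness, positive marginal utilities, second derivative negative
definite on the tangent hyperplane of the indifference surface, and indifference surfaces bounded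
from below. -/
structure IsSmoothUtility (u : (Fin (n + 1) → ℝ) → ℝ) : Prop where
  smooth : ContDiff ℝ (⊤ : ℕ∞) u
  monotone : ∀ x l, 0 < fderiv ℝ u x (Pi.single l 1)
  quasiconcave : ∀ x h, h ≠ 0 → fderiv ℝ u x h = 0 → fderiv ℝ (fderiv ℝ u) x h h < 0
  bddBelow : ∀ x, BddBelow {y | u y = u x}

/-- The set `S` of normalized prices. -/
def prices (n : ℕ) : Set (Fin (n + 1) → ℝ) :=
  {p | (∀ l, 0 < p l) ∧ p (Fin.last n) = 1}

/-- The endowment profiles `ω ∈ (ℝ^(n+1))^M` with total resources `r`, i.e. the set `Ω(r)`. -/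
def endowments (M : ℕ) (r : Fin (n + 1) → ℝ) : Set (Fin M → Fin (n + 1) → ℝ) :=
  {ω | ∑ i, ω i = r}

/-- `x` is the demand of a consumer with utility `u` at prices `p` and income `w`: it maximizes `u`
on the budget set. -/
def IsDemand (u : (Fin (n + 1) → ℝ) → ℝ) (p : Fin (n + 1) → ℝ) (w : ℝ)
    (x : Fin (n + 1) → ℝ) : Prop :=
  p ⬝ᵥ x ≤ w ∧ ∀ y, p ⬝ᵥ y ≤ w → u y ≤ u x

/-- Aggregate excess demand at the prices `p` and the endowment profile `ω` is zero. -/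
def IsEquilibrium (u : Fin M → (Fin (n + 1) → ℝ) → ℝ) (p : Fin (n + 1) → ℝ)
    (ω : Fin M → Fin (n + 1) → ℝ) : Prop :=
  ∃ x : Fin M → Fin (n + 1) → ℝ,
    (∀ i, IsDemand (u i) p (p ⬝ᵥ ω i) (x i)) ∧ ∑ i, x i = ∑ i, ω i

/-- The equilibrium manifold `E(r)`, a subset of `S × Ω(r)`. -/
def equilibriumManifold (u : Fin M → (Fin (n + 1) → ℝ) → ℝ) (r : Fin (n + 1) → ℝ) :
    Set ((Fin (n + 1) → ℝ) × (Fin M → Fin (n + 1) → ℝ)) :=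
  {z | z.1 ∈ prices n ∧ z.2 ∈ endowments M r ∧ IsEquilibrium u z.1 z.2}

/-- For two consumers, the coordinates on `S × Ω(r)` in the Euclidean space of dimension `2 n + 1`:
the non-numéraire prices and the endowment of the first consumer. They determine `(p, ω)`, since the
price of the numéraire is `1` and the endowment of the second consumer is `r - ω 0`. -/
def coords (z : (Fin (n + 1) → ℝ) × (Fin 2 → Fin (n + 1) → ℝ)) :
    EuclideanSpace ℝ (Fin n ⊕ Fin (n + 1)) :=
  WithLp.toLp 2 (Sum.elim (fun i => z.1 i.castSucc) (z.2 0))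

/-- The equilibrium manifold of a two-consumer economy as a subset of Euclidean space. -/
def euclideanEquilibriumManifold (u : Fin 2 → (Fin (n + 1) → ℝ) → ℝ) (r : Fin (n + 1) → ℝ) :
    Set (EuclideanSpace ℝ (Fin n ⊕ Fin (n + 1))) :=
  coords '' equilibriumManifold u r

end Exchange

end

/-! Everything rests on the Pareto set, the bundles of the first consumer at which both consumers
have the same supporting price. Strict quasi-concavity and boundedness below give exactly one such
bundle on each indifference surface of `u 0`, so the Pareto set is a curve `X t` indexed by utility;
the implicit function theorem makes it smooth. With `P t` the supporting price at `X t`, the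
equilibrium manifold is the union over `t` of the affine spaces `{P t} × {ω₁ | P t ⬝ᵥ ω₁ = P t ⬝ᵥ X
t}`: a ruled submanifold with one global parametrization (`isLocalParam_ruledParam`).

Both conditions say that `P` is constant. For uniqueness (`existsUnique_iff`): hyperplanes with
distinct normalized normals meet, and an endowment in the intersection has two equilibrium prices.
For curvature: if `P` is constant, the manifold lies in an affine space of its own dimension, so its
second fundamental form vanishes (`hasZeroCurvature_of_coords_const`). Conversely, take the plane
spanned by a ruling direction `∂ᵢΦ` and the transverse direction `∂ₜΦ`. Rulings are straight, so the
Gauss equation (`sum_riemann_mul_metric`) reduces the curvature to `-|II(∂ᵢ, ∂ₜ)|²`. If it vanishes,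
`∂ₜ∂ᵢΦ = -Pᵢ' e_last` is tangent, and comparing coordinates forces `Pᵢ' = 0`
(`deriv_eq_zero_of_sectionalCurvature_eq_zero`). The range of `u 0` is open and connected, so `P` is
constant. -/

namespace Embedded

/-! ### Second fundamental form and the Gauss equation in coordinates -/

section Gauss

variable {m : ℕ} {V : Type*} [NormedAddCommGroup V] [InnerProductSpace ℝ V]
  {U : Set (Fin m → ℝ)}

theorem contDiffOn_partialDeriv {F : Type*} [NormedAddCommGroup F] [NormedSpace ℝ F]
    {f : (Fin m → ℝ) → F} (hU : IsOpen U) (hf : ContDiffOn ℝ (⊤ : ℕ∞) f U) (i : Fin m) :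
    ContDiffOn ℝ (⊤ : ℕ∞) (partialDeriv i f) U := by
  have h : ContDiffOn ℝ (⊤ : ℕ∞) (fderiv ℝ f) U := hf.fderiv_of_isOpen hU (by simp)
  exact h.clm_apply contDiffOn_const

theorem differentiableAt_of_contDiffOn {F : Type*} [NormedAddCommGroup F] [NormedSpace ℝ F]
    {f : (Fin m → ℝ) → F} (hU : IsOpen U) (hf : ContDiffOn ℝ (⊤ : ℕ∞) f U) {x : Fin m → ℝ}
    (hx : x ∈ U) : DifferentiableAt ℝ f x :=
  (hf.contDiffAt (hU.mem_nhds hx)).differentiableAt (by simp)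

theorem partialDeriv_comm {F : Type*} [NormedAddCommGroup F] [NormedSpace ℝ F]
    {f : (Fin m → ℝ) → F} (hU : IsOpen U) (hf : ContDiffOn ℝ (⊤ : ℕ∞) f U) {x : Fin m → ℝ}
    (hx : x ∈ U) (i j : Fin m) :
    partialDeriv i (partialDeriv j f) x = partialDeriv j (partialDeriv i f) x := by
  have hd : DifferentiableAt ℝ (fderiv ℝ f) x := by
    have h : ContDiffOn ℝ (⊤ : ℕ∞) (fderiv ℝ f) U := hf.fderiv_of_isOpen hU (by simp)
    exact differentiableAt_of_contDiffOn hU h hx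
  have key : ∀ a b : Fin m, partialDeriv a (partialDeriv b f) x
      = fderiv ℝ (fderiv ℝ f) x (Pi.single a 1) (Pi.single b 1) := by
    intro a b
    change fderiv ℝ (fun y => fderiv ℝ f y (Pi.single b 1)) x (Pi.single a 1) = _
    rw [fderiv_clm_apply hd (differentiableAt_const _)]
    simp
  have hs : IsSymmSndFDerivAt ℝ f x :=
    (hf.contDiffAt (hU.mem_nhds hx)).isSymmSndFDerivAt
      (by simpa using WithTop.coe_le_coe.2 (le_top (a := (2 : ℕ∞))))
  rw [key, key, hs.eq]

theorem partialDeriv_congr {F : Type*} [NormedAddCommGroup F] [NormedSpace ℝ F]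
    {f g : (Fin m → ℝ) → F} (hU : IsOpen U) {x : Fin m → ℝ} (hx : x ∈ U)
    (h : ∀ y ∈ U, f y = g y) (i : Fin m) : partialDeriv i f x = partialDeriv i g x := by
  have : f =ᶠ[nhds x] g := Filter.eventuallyEq_of_mem (hU.mem_nhds hx) h
  rw [partialDeriv, partialDeriv, this.fderiv_eq]

variable {Φ : (Fin m → ℝ) → V}

theorem linearIndependent_partialDeriv {x : Fin m → ℝ}
    (h : Function.Injective (fderiv ℝ Φ x)) :
    LinearIndependent ℝ (fun i => partialDeriv i Φ x) := by
  have := (Pi.basisFun ℝ (Fin m)).linearIndependent.map'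
    (fderiv ℝ Φ x).toLinearMap (LinearMap.ker_eq_bot.2 h)
  convert! this using 2 with i
  simp [partialDeriv]

theorem metric_eq_gram (x : Fin m → ℝ) :
    metric Φ x = Matrix.gram ℝ (fun i => partialDeriv i Φ x) := rfl

theorem metric_apply (x : Fin m → ℝ) (i j : Fin m) :
    metric Φ x i j = inner ℝ (partialDeriv i Φ x) (partialDeriv j Φ x) := rfl

theorem det_metric_ne_zero {x : Fin m → ℝ} (h : Function.Injective (fderiv ℝ Φ x)) :
    (metric Φ x).det ≠ 0 := by
  rw [metric_eq_gram, Matrix.det_gram_ne_zero_iff_linearIndependent]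
  exact linearIndependent_partialDeriv h

theorem contDiffOn_metric (hU : IsOpen U) (hΦ : ContDiffOn ℝ (⊤ : ℕ∞) Φ U) (i j : Fin m) :
    ContDiffOn ℝ (⊤ : ℕ∞) (fun y => metric Φ y i j) U :=
  (contDiffOn_partialDeriv hU hΦ i).inner ℝ (contDiffOn_partialDeriv hU hΦ j)

theorem contDiffOn_det {E : Type*} [NormedAddCommGroup E] [NormedSpace ℝ E] {s : Set E}
    {A : E → Matrix (Fin m) (Fin m) ℝ}
    (hA : ∀ i j, ContDiffOn ℝ (⊤ : ℕ∞) (fun y => A y i j) s) :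
    ContDiffOn ℝ (⊤ : ℕ∞) (fun y => (A y).det) s := by
  simp only [Matrix.det_apply']
  exact ContDiffOn.sum fun σ _ => contDiffOn_const.mul (contDiffOn_prod fun i _ => hA _ _)

theorem contDiffOn_matrix_inv {E : Type*} [NormedAddCommGroup E] [NormedSpace ℝ E] {s : Set E}
    {A : E → Matrix (Fin m) (Fin m) ℝ}
    (hA : ∀ i j, ContDiffOn ℝ (⊤ : ℕ∞) (fun y => A y i j) s)
    (hd : ∀ y ∈ s, (A y).det ≠ 0) (i j : Fin m) :
    ContDiffOn ℝ (⊤ : ℕ∞) (fun y => (A y)⁻¹ i j) s := by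
  simp only [Matrix.inv_def, Matrix.smul_apply, Ring.inverse_eq_inv', Matrix.adjugate_apply,
    smul_eq_mul]
  refine ((contDiffOn_det hA).inv hd).mul (contDiffOn_det fun a b => ?_)
  by_cases h : a = j
  · subst h
    simpa using contDiffOn_const
  · simpa [Matrix.updateRow_ne h] using hA a b

theorem partialDeriv_metric (hU : IsOpen U) (hΦ : ContDiffOn ℝ (⊤ : ℕ∞) Φ U)
    {x : Fin m → ℝ} (hx : x ∈ U) (k i j : Fin m) :
    partialDeriv k (fun y => metric Φ y i j) x
      = inner ℝ (partialDeriv k (partialDeriv i Φ) x) (partialDeriv j Φ x)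
        + inner ℝ (partialDeriv i Φ x) (partialDeriv k (partialDeriv j Φ) x) := by
  have hd := fun i => differentiableAt_of_contDiffOn hU (contDiffOn_partialDeriv hU hΦ i) hx
  simp only [metric_apply]
  rw [partialDeriv, fderiv_inner_apply ℝ (hd i) (hd j), add_comm]
  rfl

/-- Expanding the derivatives of the metric gives six terms; by symmetry of second derivatives four
cancel and the other two agree. The Christoffel symbols are thus the coefficients of the tangential
projection of `∂ᵢ∂ⱼΦ`. -/
theorem christoffel_eq (hU : IsOpen U) (hΦ : ContDiffOn ℝ (⊤ : ℕ∞) Φ U)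
    {x : Fin m → ℝ} (hx : x ∈ U) (i j k : Fin m) :
    christoffel Φ i j k x = ∑ h, (metric Φ x)⁻¹ h k *
      inner ℝ (partialDeriv i (partialDeriv j Φ) x) (partialDeriv h Φ x) := by
  rw [christoffel, Finset.mul_sum]
  refine Finset.sum_congr rfl fun h _ => ?_
  simp only [partialDeriv_metric hU hΦ hx]
  rw [partialDeriv_comm hU hΦ hx j i, partialDeriv_comm hU hΦ hx h i,
    partialDeriv_comm hU hΦ hx h j,
    real_inner_comm (partialDeriv h Φ x) (partialDeriv i (partialDeriv j Φ) x),
    real_inner_comm (partialDeriv j Φ x) (partialDeriv i (partialDeriv h Φ) x),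
    real_inner_comm (partialDeriv i Φ x) (partialDeriv j (partialDeriv h Φ) x)]
  ring

theorem sum_christoffel_mul_metric (hU : IsOpen U) (hΦ : ContDiffOn ℝ (⊤ : ℕ∞) Φ U)
    {x : Fin m → ℝ} (hinj : Function.Injective (fderiv ℝ Φ x))
    (hx : x ∈ U) (i j l : Fin m) :
    ∑ k, christoffel Φ i j k x * metric Φ x k l
      = inner ℝ (partialDeriv i (partialDeriv j Φ) x) (partialDeriv l Φ x) := by
  simp only [christoffel_eq hU hΦ hx, Finset.sum_mul]
  rw [Finset.sum_comm]
  have h1 : ∀ h, ∑ k, (metric Φ x)⁻¹ h k * metric Φ x k l = if h = l then 1 else 0 := by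
    intro h
    rw [← Matrix.mul_apply, Matrix.nonsing_inv_mul _ (det_metric_ne_zero hinj).isUnit,
      Matrix.one_apply]
  have h2 : ∀ h, ∑ k, (metric Φ x)⁻¹ h k *
      inner ℝ (partialDeriv i (partialDeriv j Φ) x) (partialDeriv h Φ x) * metric Φ x k l
      = (if h = l then 1 else 0)
        * inner ℝ (partialDeriv i (partialDeriv j Φ) x) (partialDeriv h Φ x) := by
    intro h
    rw [← h1, Finset.sum_mul]
    exact Finset.sum_congr rfl fun k _ => by ring
  simp [h2]

theorem contDiffOn_christoffel (hU : IsOpen U) (hΦ : ContDiffOn ℝ (⊤ : ℕ∞) Φ U)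
    (hinj : ∀ x ∈ U, Function.Injective (fderiv ℝ Φ x)) (i j k : Fin m) :
    ContDiffOn ℝ (⊤ : ℕ∞) (christoffel Φ i j k) U := by
  refine contDiffOn_const.mul (ContDiffOn.sum fun h _ => ?_)
  refine (contDiffOn_matrix_inv (contDiffOn_metric hU hΦ)
    (fun y hy => det_metric_ne_zero (hinj y hy)) h k).mul ?_
  exact ((contDiffOn_partialDeriv hU (contDiffOn_metric hU hΦ _ _) _).add
    (contDiffOn_partialDeriv hU (contDiffOn_metric hU hΦ _ _) _)).sub
    (contDiffOn_partialDeriv hU (contDiffOn_metric hU hΦ _ _) _)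

/-- The coefficients of the second fundamental form, as normal vectors. -/
noncomputable def secondForm (Φ : (Fin m → ℝ) → V) (i j : Fin m) (x : Fin m → ℝ) : V :=
  partialDeriv i (partialDeriv j Φ) x - ∑ l, christoffel Φ i j l x • partialDeriv l Φ x

theorem inner_secondForm (hU : IsOpen U) (hΦ : ContDiffOn ℝ (⊤ : ℕ∞) Φ U)
    {x : Fin m → ℝ} (hinj : Function.Injective (fderiv ℝ Φ x))
    (hx : x ∈ U) (i j l : Fin m) :
    inner ℝ (secondForm Φ i j x) (partialDeriv l Φ x) = 0 := by
  rw [secondForm, inner_sub_left, sum_inner, ← sum_christoffel_mul_metric hU hΦ hinj hx]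
  simp [inner_smul_left, metric_apply]

/-- Differentiate the identity `sum_christoffel_mul_metric` and solve for the terms containing
derivatives of Christoffel symbols. This avoids ever differentiating the inverse metric explicitly.
-/
theorem sum_partialDeriv_christoffel (hU : IsOpen U) (hΦ : ContDiffOn ℝ (⊤ : ℕ∞) Φ U)
    (hinj : ∀ x ∈ U, Function.Injective (fderiv ℝ Φ x)) {x : Fin m → ℝ} (hx : x ∈ U)
    (j i k s : Fin m) :
    ∑ l, partialDeriv j (christoffel Φ i k l) x * metric Φ x l s
      = inner ℝ (partialDeriv j (partialDeriv i (partialDeriv k Φ)) x) (partialDeriv s Φ x)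
        + inner ℝ (secondForm Φ i k x) (partialDeriv j (partialDeriv s Φ) x)
        - ∑ l, christoffel Φ i k l x *
            inner ℝ (partialDeriv j (partialDeriv l Φ) x) (partialDeriv s Φ x) := by
  have hdΦ := fun i => contDiffOn_partialDeriv hU hΦ i
  have hd2 := contDiffOn_partialDeriv hU (hdΦ k) i
  have e1 : partialDeriv j (fun y => ∑ l, christoffel Φ i k l y * metric Φ y l s) x
      = partialDeriv j (fun y =>
        inner ℝ (partialDeriv i (partialDeriv k Φ) y) (partialDeriv s Φ y)) x :=
    partialDeriv_congr hU hx
      (fun y hy => sum_christoffel_mul_metric hU hΦ (hinj y hy) hy i k s) j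
  have e2 : partialDeriv j (fun y =>
        inner ℝ (partialDeriv i (partialDeriv k Φ) y) (partialDeriv s Φ y)) x
      = inner ℝ (partialDeriv i (partialDeriv k Φ) x) (partialDeriv j (partialDeriv s Φ) x)
       + inner ℝ (partialDeriv j (partialDeriv i (partialDeriv k Φ)) x) (partialDeriv s Φ x) := by
    rw [partialDeriv, fderiv_inner_apply ℝ (differentiableAt_of_contDiffOn hU hd2 hx)
      (differentiableAt_of_contDiffOn hU (hdΦ s) hx)]
    rfl
  have hc := fun l => differentiableAt_of_contDiffOn hU (contDiffOn_christoffel hU hΦ hinj i k l) hx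
  have hg := fun l => differentiableAt_of_contDiffOn hU (contDiffOn_metric hU hΦ l s) hx
  have e3 : partialDeriv j (fun y => ∑ l, christoffel Φ i k l y * metric Φ y l s) x
      = ∑ l, (christoffel Φ i k l x * partialDeriv j (fun y => metric Φ y l s) x
        + metric Φ x l s * partialDeriv j (christoffel Φ i k l) x) := by
    rw [partialDeriv, fderiv_fun_sum (A := fun l y => christoffel Φ i k l y * metric Φ y l s)
      fun l _ => (hc l).mul (hg l)]
    simp only [sum_apply]
    refine Finset.sum_congr rfl fun l _ => ?_
    rw [fderiv_fun_mul (hc l) (hg l)]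
    rfl
  rw [e3, e2] at e1
  simp only [partialDeriv_metric hU hΦ hx, mul_add, Finset.sum_add_distrib] at e1
  rw [secondForm, inner_sub_left, sum_inner]
  simp only [inner_smul_left, RCLike.conj_to_real, mul_comm (partialDeriv j _ x)]
  linarith

/-- The Gauss equation. -/
theorem sum_riemann_mul_metric (hU : IsOpen U) (hΦ : ContDiffOn ℝ (⊤ : ℕ∞) Φ U)
    (hinj : ∀ x ∈ U, Function.Injective (fderiv ℝ Φ x)) {x : Fin m → ℝ} (hx : x ∈ U)
    (i j k s : Fin m) :
    ∑ l, riemann Φ i j k l x * metric Φ x l s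
      = inner ℝ (secondForm Φ i k x) (partialDeriv j (partialDeriv s Φ) x)
        - inner ℝ (secondForm Φ j k x) (partialDeriv i (partialDeriv s Φ) x) := by
  have quad : ∀ i j, ∑ a, (∑ l, christoffel Φ i k l x * christoffel Φ j l a x) * metric Φ x a s
      = ∑ l, christoffel Φ i k l x *
          inner ℝ (partialDeriv j (partialDeriv l Φ) x) (partialDeriv s Φ x) := by
    intro i j
    simp only [Finset.sum_mul]
    rw [Finset.sum_comm]
    refine Finset.sum_congr rfl fun l _ => ?_
    rw [← sum_christoffel_mul_metric hU hΦ (hinj x hx) hx, Finset.mul_sum]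
    exact Finset.sum_congr rfl fun a _ => by ring
  -- Third derivatives cancel by symmetry, and the terms `quad` cancel the last sum of
  -- `sum_partialDeriv_christoffel`; only the second-form terms survive.
  have third : partialDeriv j (partialDeriv i (partialDeriv k Φ)) x
      = partialDeriv i (partialDeriv j (partialDeriv k Φ)) x :=
    partialDeriv_comm hU (contDiffOn_partialDeriv hU hΦ k) hx j i
  simp only [riemann, add_mul, sub_mul, Finset.sum_add_distrib, Finset.sum_sub_distrib, quad,
    sum_partialDeriv_christoffel hU hΦ hinj hx, third]
  ring

theorem curvatureForm_single (x : Fin m → ℝ) (i j : Fin m) :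
    curvatureForm Φ x (Pi.single i 1) (Pi.single j 1)
      = ∑ l, riemann Φ i j i l x * metric Φ x l j := by
  simp only [curvatureForm, Pi.single_apply, ite_mul, mul_ite, one_mul, zero_mul, mul_zero,
    mul_one, Finset.sum_ite_eq', Finset.mem_univ, if_true]

theorem metricForm_eq_inner (x a b : Fin m → ℝ) :
    metricForm Φ x a b = inner ℝ (fderiv ℝ Φ x a) (fderiv ℝ Φ x b) := by
  have h : ∀ a : Fin m → ℝ, fderiv ℝ Φ x a = ∑ i, a i • partialDeriv i Φ x := by
    intro a
    conv_lhs => rw [pi_eq_sum_univ' a]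
    rw [map_sum]
    refine Finset.sum_congr rfl fun i _ => ?_
    rw [map_smul, partialDeriv]
  simp only [h, sum_inner, inner_sum, inner_smul_left, inner_smul_right, metricForm, metric_apply,
    RCLike.conj_to_real, Finset.mul_sum]
  rw [Finset.sum_comm]
  exact Finset.sum_congr rfl fun i _ => Finset.sum_congr rfl fun j _ => by ring

/-- The expression is the Gram determinant of two independent tangent vectors. It allows zero
sectional curvature to be read as a zero numerator, not as a division by zero. -/
theorem metricForm_area_ne_zero {x a b : Fin m → ℝ}
    (hinj : Function.Injective (fderiv ℝ Φ x)) (hab : LinearIndependent ℝ ![a, b]) :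
    metricForm Φ x a a * metricForm Φ x b b - metricForm Φ x a b ^ 2 ≠ 0 := by
  have hli := hab.map' (fderiv ℝ Φ x).toLinearMap (LinearMap.ker_eq_bot.2 hinj)
  have hdet := Matrix.det_gram_ne_zero_iff_linearIndependent.2 hli
  rw [Matrix.det_fin_two] at hdet
  simp only [Matrix.gram_apply, Function.comp_apply, Matrix.cons_val_zero, Matrix.cons_val_one,
    ContinuousLinearMap.coe_coe] at hdet
  rw [metricForm_eq_inner, metricForm_eq_inner, metricForm_eq_inner, sq]
  rwa [real_inner_comm (fderiv ℝ Φ x a) (fderiv ℝ Φ x b)] at hdet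

end Gauss

end Embedded

/-! ### Supporting prices and demand of a single consumer -/

namespace Exchange

open Filter Topology

variable {n : ℕ}

/-- The normalized prices that support the bundle `x`: marginal rates of substitution with respect
to the numéraire. -/
noncomputable def supportPrice (u : (Fin (n + 1) → ℝ) → ℝ) (x : Fin (n + 1) → ℝ) :
    Fin (n + 1) → ℝ :=
  fun l => fderiv ℝ u x (Pi.single l 1) / fderiv ℝ u x (Pi.single (Fin.last n) 1)

/-- A function that decreases at each of its zeros cannot cross zero upwards; touching zero from
below would be a local maximum, where the derivative vanishes. -/
theorem neg_of_hasDerivAt_neg_at_zeros {g g' : ℝ → ℝ} (hg : ∀ s, HasDerivAt g (g' s) s)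
    (h0 : g 0 ≤ 0) (hz : ∀ s, g s = 0 → g' s < 0) {s : ℝ} (hs : 0 < s) : g s < 0 := by
  have hle : ∀ t, 0 ≤ t → g t ≤ 0 := by
    intro t ht
    have hc : Continuous g := continuous_iff_continuousAt.2 fun t => (hg t).continuousAt
    exact image_le_of_deriv_right_lt_deriv_boundary (B := fun _ => 0) (B' := fun _ => 0)
      hc.continuousOn (fun x _ => (hg x).hasDerivWithinAt) h0 (fun x => hasDerivAt_const x 0)
      (fun x _ hx => hz x hx) ⟨ht, le_rfl⟩
  refine lt_of_le_of_ne (hle s hs.le) fun h => ?_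
  have hmax : IsLocalMax g s := by
    filter_upwards [lt_mem_nhds hs] with t ht
    rw [h]
    exact hle t ht.le
  exact (hz s h).ne (hmax.hasDerivAt_eq_zero (hg s))

/-- Lagrange multipliers with the multiplier eliminated. It serves both the consumer's problem and
Pareto optimality. -/
theorem IsLocalExtrOn.ratio_eq {f φ : (Fin (n + 1) → ℝ) → ℝ}
    {f' φ' : (Fin (n + 1) → ℝ) →L[ℝ] ℝ} {x : Fin (n + 1) → ℝ}
    (hext : IsLocalExtrOn φ {y | f y = f x} x) (hf : HasStrictFDerivAt f f' x)
    (hφ : HasStrictFDerivAt φ φ' x) (hf0 : ∀ l, f' (Pi.single l 1) ≠ 0)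
    (hφ0 : ∀ l, φ' (Pi.single l 1) ≠ 0) (l k : Fin (n + 1)) :
    f' (Pi.single l 1) / f' (Pi.single k 1) = φ' (Pi.single l 1) / φ' (Pi.single k 1) := by
  obtain ⟨a, b, hab, h⟩ := hext.exists_multipliers_of_hasStrictFDerivAt_1d hf hφ
  have he : ∀ l, a * f' (Pi.single l 1) + b * φ' (Pi.single l 1) = 0 := fun l => by
    simpa using congrArg (fun T : (Fin (n + 1) → ℝ) →L[ℝ] ℝ => T (Pi.single l 1)) h
  have hb : b ≠ 0 := by
    rintro rfl
    have := he l
    simp only [zero_mul, add_zero, mul_eq_zero, hf0 l, or_false] at this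
    exact hab (by simp [this])
  rw [div_eq_div_iff (hf0 k) (hφ0 k)]
  apply mul_left_cancel₀ hb
  linear_combination (f' (Pi.single l 1)) * he k - (f' (Pi.single k 1)) * he l

namespace IsSmoothUtility

variable {u : (Fin (n + 1) → ℝ) → ℝ} (hu : IsSmoothUtility u)

include hu

theorem differentiableAt (x : Fin (n + 1) → ℝ) : DifferentiableAt ℝ u x :=
  (hu.smooth.differentiable (by simp)) x

theorem contDiff_fderiv : ContDiff ℝ (⊤ : ℕ∞) (fderiv ℝ u) :=
  hu.smooth.fderiv_right (by simp)

theorem fderiv_apply_eq (x h : Fin (n + 1) → ℝ) :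
    fderiv ℝ u x h = fderiv ℝ u x (Pi.single (Fin.last n) 1) * (supportPrice u x ⬝ᵥ h) := by
  have h0 := (hu.monotone x (Fin.last n)).ne'
  conv_lhs => rw [pi_eq_sum_univ' h]
  rw [map_sum, dotProduct, Finset.mul_sum]
  refine Finset.sum_congr rfl fun i _ => ?_
  rw [map_smul, supportPrice, smul_eq_mul, ← mul_assoc, mul_div_cancel₀ _ h0, mul_comm]

theorem supportPrice_mem (x : Fin (n + 1) → ℝ) : supportPrice u x ∈ prices n :=
  ⟨fun l => div_pos (hu.monotone x l) (hu.monotone x _), div_self (hu.monotone x _).ne'⟩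

theorem contDiff_supportPrice : ContDiff ℝ (⊤ : ℕ∞) (supportPrice u) :=
  contDiff_pi.2 fun _ => (hu.contDiff_fderiv.clm_apply contDiff_const).div
    (hu.contDiff_fderiv.clm_apply contDiff_const) fun x => (hu.monotone x _).ne'

theorem hasDerivAt_line (x h : Fin (n + 1) → ℝ) (s : ℝ) :
    HasDerivAt (fun s : ℝ => u (x + s • h)) (fderiv ℝ u (x + s • h) h) s := by
  have hl : HasDerivAt (fun s : ℝ => x + s • h) h s := by
    simpa using ((hasDerivAt_id s).smul_const h).const_add x
  exact (hu.differentiableAt (x + s • h)).hasFDerivAt.comp_hasDerivAt s hl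

theorem hasDerivAt_fderiv_line (x h : Fin (n + 1) → ℝ) (s : ℝ) :
    HasDerivAt (fun s : ℝ => fderiv ℝ u (x + s • h) h)
      (fderiv ℝ (fderiv ℝ u) (x + s • h) h h) s := by
  have hl : HasDerivAt (fun s : ℝ => x + s • h) h s := by
    simpa using ((hasDerivAt_id s).smul_const h).const_add x
  have hd : DifferentiableAt ℝ (fderiv ℝ u) (x + s • h) :=
    hu.contDiff_fderiv.differentiable (by simp) _
  have h1 := hd.hasFDerivAt.comp_hasDerivAt s hl
  simpa using h1.clm_apply (hasDerivAt_const s h)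

/-- Strict quasi-concavity: the supporting prices at `x` support the preferred set of `x`. -/
theorem lt_of_dotProduct_le {x y : Fin (n + 1) → ℝ} (hxy : y ≠ x)
    (h : supportPrice u x ⬝ᵥ y ≤ supportPrice u x ⬝ᵥ x) : u y < u x := by
  have hne : y - x ≠ 0 := sub_ne_zero.2 hxy
  have hneg : ∀ s : ℝ, 0 < s → fderiv ℝ u (x + s • (y - x)) (y - x) < 0 := by
    intro s hs
    refine neg_of_hasDerivAt_neg_at_zeros (hu.hasDerivAt_fderiv_line x (y - x)) ?_
      (fun s hs => hu.quasiconcave _ _ hne hs) hs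
    rw [zero_smul, add_zero, hu.fderiv_apply_eq, dotProduct_sub]
    exact mul_nonpos_of_nonneg_of_nonpos (hu.monotone x _).le (by linarith)
  have hanti : StrictAntiOn (fun s : ℝ => u (x + s • (y - x))) (Set.Icc 0 1) := by
    refine strictAntiOn_of_deriv_neg (convex_Icc 0 1) ?_ ?_
    · exact fun s _ => (hu.hasDerivAt_line x (y - x) s).continuousAt.continuousWithinAt
    · intro s hs
      rw [interior_Icc] at hs
      rw [(hu.hasDerivAt_line x (y - x) s).deriv]
      exact hneg s hs.1
  simpa using hanti (Set.left_mem_Icc.2 zero_le_one) (Set.right_mem_Icc.2 zero_le_one) one_pos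

theorem eq_of_supportPrice_eq {x y : Fin (n + 1) → ℝ} (hp : supportPrice u x = supportPrice u y)
    (h : u x = u y) : x = y := by
  by_contra hne
  rcases le_total (supportPrice u x ⬝ᵥ y) (supportPrice u x ⬝ᵥ x) with h1 | h1
  · exact absurd h (hu.lt_of_dotProduct_le (Ne.symm hne) h1).ne'
  · rw [hp] at h1
    exact absurd h (hu.lt_of_dotProduct_le hne h1).ne

theorem strictMono : StrictMono u := by
  intro x y hxy
  have hpos : ∀ z, 0 < fderiv ℝ u z (y - x) := by
    intro z
    rw [hu.fderiv_apply_eq]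
    refine mul_pos (hu.monotone z _) ?_
    obtain ⟨hle, i, hi⟩ := Pi.lt_def.1 hxy
    refine Finset.sum_pos' (fun j _ => mul_nonneg ((hu.supportPrice_mem z).1 j).le ?_)
      ⟨i, Finset.mem_univ i, mul_pos ((hu.supportPrice_mem z).1 i) ?_⟩
    · exact sub_nonneg.2 (hle j)
    · exact sub_pos.2 hi
  have hmono : StrictMono (fun s : ℝ => u (x + s • (y - x))) :=
    strictMono_of_hasDerivAt_pos (hu.hasDerivAt_line x (y - x)) fun s => hpos _
  simpa using hmono one_pos

/-- From a point of the upper level set, descend along the diagonal until the indifference surface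
of `x` is met; a lower bound of that surface lies below the meeting point, hence below the start. -/
theorem bddBelow_superlevel (x : Fin (n + 1) → ℝ) : BddBelow {y | u x ≤ u y} := by
  obtain ⟨b, hb⟩ := hu.bddBelow x
  refine ⟨b, fun y hy => ?_⟩
  have hcont : ContinuousOn (fun s : ℝ => u (y - fun _ => s)) (Set.Icc 0 ‖y - x‖) :=
    (hu.smooth.continuous.comp (by fun_prop)).continuousOn
  have hlow : u (y - fun _ => ‖y - x‖) ≤ u x := by
    refine hu.strictMono.monotone fun l => ?_
    have := (le_abs_self _).trans (norm_le_pi_norm (y - x) l)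
    simp only [Pi.sub_apply] at this ⊢
    linarith
  obtain ⟨s, hs, hsx⟩ := intermediate_value_Icc' (norm_nonneg (y - x)) hcont
    ⟨hlow, by simpa [← Pi.zero_def] using hy⟩
  intro l
  have := hb hsx l
  simp only [Pi.sub_apply] at this
  linarith [hs.1]

theorem supportPrice_eq_of_isMaxOn {p x : Fin (n + 1) → ℝ} (hp : p ∈ prices n)
    (h : IsMaxOn u {y | p ⬝ᵥ y = p ⬝ᵥ x} x) : supportPrice u x = p := by
  let f' : (Fin (n + 1) → ℝ) →L[ℝ] ℝ := (dotProductBilin ℝ ℝ p).toContinuousLinearMap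
  have hf' : ∀ y, f' y = p ⬝ᵥ y := fun y => rfl
  have hs : ∀ l, f' (Pi.single l 1) = p l := fun l => by rw [hf', dotProduct_single_one]
  have hf : HasStrictFDerivAt (fun y => p ⬝ᵥ y) f' x := f'.hasStrictFDerivAt
  have hφ : HasStrictFDerivAt u (fderiv ℝ u x) x :=
    hu.smooth.contDiffAt.hasStrictFDerivAt (by simp)
  ext l
  have := IsLocalExtrOn.ratio_eq (Or.inr h.localize) hf hφ
    (fun l => by rw [hs]; exact (hp.1 l).ne') (fun l => (hu.monotone x l).ne') l (Fin.last n)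
  rw [hs, hs, hp.2, div_one] at this
  exact this.symm

theorem isDemand_iff {p x : Fin (n + 1) → ℝ} (hp : p ∈ prices n) (w : ℝ) :
    IsDemand u p w x ↔ p ⬝ᵥ x = w ∧ supportPrice u x = p := by
  constructor
  · rintro ⟨hle, hmax⟩
    have heq : p ⬝ᵥ x = w := by
      by_contra hne
      have hlt : 0 < w - p ⬝ᵥ x := sub_pos.2 (lt_of_le_of_ne hle hne)
      -- Unspent income would be spent on the numéraire, whose price is 1.
      have h1 := hmax (x + Pi.single (Fin.last n) (w - p ⬝ᵥ x)) (by
        rw [dotProduct_add, dotProduct_single, hp.2]; linarith)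
      exact absurd h1 (not_le.2 (hu.strictMono (lt_add_of_pos_right _ (Pi.single_pos.2 hlt))))
    refine ⟨heq, hu.supportPrice_eq_of_isMaxOn hp fun y hy => ?_⟩
    exact hmax y (by rw [← heq]; exact le_of_eq hy)
  · rintro ⟨rfl, rfl⟩
    refine ⟨le_rfl, fun y hy => ?_⟩
    by_cases h : y = x
    · rw [h]
    · exact (hu.lt_of_dotProduct_le h hy).le

/-- On the budget hyperplane the bundles at least as good as `x₀` form a compact set: they are
bounded below by assumption, and then above because all prices are positive. -/
theorem exists_demand {p : Fin (n + 1) → ℝ} (hp : p ∈ prices n) (w : ℝ) :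
    ∃ x, p ⬝ᵥ x = w ∧ supportPrice u x = p := by
  let x₀ : Fin (n + 1) → ℝ := Pi.single (Fin.last n) w
  have hx₀ : p ⬝ᵥ x₀ = w := by rw [dotProduct_single, hp.2, one_mul]
  obtain ⟨b, hb⟩ := hu.bddBelow_superlevel x₀
  have hcp : Continuous fun y : Fin (n + 1) → ℝ => p ⬝ᵥ y := by
    unfold dotProduct; fun_prop
  have hcu := hu.smooth.continuous
  have hK : IsCompact {y | p ⬝ᵥ y = w ∧ u x₀ ≤ u y} := by
    refine (isCompact_Icc (a := b) (b := fun l => b l + (w - p ⬝ᵥ b) / p l)).of_isClosed_subset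
      ((isClosed_eq hcp continuous_const).inter (isClosed_le continuous_const hcu)) ?_
    rintro y ⟨hy, hy'⟩
    have hby := hb hy'
    refine ⟨hby, fun l => ?_⟩
    have h1 : p l * (y l - b l) ≤ p ⬝ᵥ (y - b) :=
      Finset.single_le_sum (f := fun i => p i * (y - b) i)
        (fun i _ => mul_nonneg (hp.1 i).le (sub_nonneg.2 (hby i))) (Finset.mem_univ l)
    rw [dotProduct_sub, hy, mul_comm, ← le_div_iff₀ (hp.1 l)] at h1
    linarith
  obtain ⟨x, ⟨hx, hx'⟩, hmax⟩ := hK.exists_isMaxOn ⟨x₀, hx₀, le_rfl⟩ hcu.continuousOn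
  refine ⟨x, hx, hu.supportPrice_eq_of_isMaxOn hp fun y hy => ?_⟩
  rcases le_total (u x₀) (u y) with h | h
  · exact hmax ⟨by rw [← hx]; exact hy, h⟩
  · exact h.trans hx'

end IsSmoothUtility

/-! ### The Pareto set and uniqueness of equilibrium -/

/-- The bundles of the first consumer in the Pareto optimal allocations of `r`. -/
def paretoSet (u : Fin 2 → (Fin (n + 1) → ℝ) → ℝ) (r : Fin (n + 1) → ℝ) :
    Set (Fin (n + 1) → ℝ) :=
  {x | supportPrice (u 0) x = supportPrice (u 1) (r - x)}

variable {u : Fin 2 → (Fin (n + 1) → ℝ) → ℝ} (hu : ∀ i, IsSmoothUtility (u i))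
  {r : Fin (n + 1) → ℝ}

include hu

/-- At the supporting price of one Pareto bundle, any other bundle of equal utility costs more, so
it leaves the second consumer a cheaper and strictly worse remainder. For two Pareto bundles this
would hold both ways. -/
theorem paretoSet_injOn : Set.InjOn (u 0) (paretoSet u r) := by
  intro x hx y hy h
  by_contra hne
  have key : ∀ x ∈ paretoSet u r, ∀ y, u 0 x = u 0 y → x ≠ y → u 1 (r - y) < u 1 (r - x) := by
    intro x hx y h hne
    refine (hu 1).lt_of_dotProduct_le (fun he => hne (sub_right_injective he).symm) ?_
    have h1 : supportPrice (u 0) x ⬝ᵥ x < supportPrice (u 0) x ⬝ᵥ y := by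
      by_contra hle
      exact absurd h ((hu 0).lt_of_dotProduct_le (Ne.symm hne) (not_lt.1 hle)).ne'
    rw [← show supportPrice (u 0) x = supportPrice (u 1) (r - x) from hx, dotProduct_sub,
      dotProduct_sub]
    linarith
  exact lt_asymm (key x hx y h hne) (key y hy x h.symm (Ne.symm hne))

/-- Maximize the second consumer's utility on an indifference surface of the first. The feasible set
is compact since both consumers' bundles are bounded below and their sum is fixed; Lagrange's
condition equates the supporting prices. -/
theorem exists_mem_paretoSet (x₀ : Fin (n + 1) → ℝ) : ∃ x ∈ paretoSet u r, u 0 x = u 0 x₀ := by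
  obtain ⟨b, hb⟩ := (hu 0).bddBelow_superlevel x₀
  obtain ⟨c, hc⟩ := (hu 1).bddBelow_superlevel (r - x₀)
  have hcu0 := (hu 0).smooth.continuous
  have hcu1 : Continuous fun x => u 1 (r - x) := (hu 1).smooth.continuous.comp (by fun_prop)
  have hK : IsCompact {y | u 0 y = u 0 x₀ ∧ u 1 (r - x₀) ≤ u 1 (r - y)} := by
    refine (isCompact_Icc (a := b) (b := r - c)).of_isClosed_subset
      ((isClosed_eq hcu0 continuous_const).inter (isClosed_le continuous_const hcu1)) ?_
    rintro y ⟨hy, hy'⟩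
    exact ⟨hb hy.ge, le_sub_comm.1 (hc hy')⟩
  obtain ⟨x, ⟨hx, hx'⟩, hmax⟩ := hK.exists_isMaxOn ⟨x₀, rfl, le_rfl⟩ hcu1.continuousOn
  refine ⟨x, ?_, hx⟩
  have hmax' : IsMaxOn (fun x => u 1 (r - x)) {y | u 0 y = u 0 x} x := by
    intro y hy
    rcases le_total (u 1 (r - x₀)) (u 1 (r - y)) with h | h
    · exact hmax ⟨by rw [← hx]; exact hy, h⟩
    · exact h.trans hx'
  have hf : HasStrictFDerivAt (u 0) (fderiv ℝ (u 0) x) x :=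
    (hu 0).smooth.contDiffAt.hasStrictFDerivAt (by simp)
  have hφ : HasStrictFDerivAt (fun x => u 1 (r - x)) (-fderiv ℝ (u 1) (r - x)) x := by
    have h1 : HasStrictFDerivAt (u 1) (fderiv ℝ (u 1) (r - x)) (r - x) :=
      (hu 1).smooth.contDiffAt.hasStrictFDerivAt (by simp)
    simpa using h1.comp x ((hasStrictFDerivAt_id x).const_sub r)
  ext l
  have := IsLocalExtrOn.ratio_eq (Or.inr hmax'.localize) hf hφ
    (fun l => ((hu 0).monotone x l).ne')
    (fun l => by simpa using ((hu 1).monotone (r - x) l).ne') l (Fin.last n)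
  simpa [supportPrice, neg_div_neg_eq] using this

/-- At equilibrium both demands have supporting price `p`, so the allocation is Pareto optimal. The
second budget equation follows from the first and the resource constraint. -/
theorem mem_equilibriumManifold_iff (p : Fin (n + 1) → ℝ) (ω : Fin 2 → Fin (n + 1) → ℝ) :
    (p, ω) ∈ equilibriumManifold u r ↔
      ω 1 = r - ω 0 ∧ ∃ x ∈ paretoSet u r, supportPrice (u 0) x = p ∧ p ⬝ᵥ ω 0 = p ⬝ᵥ x := by
  simp only [equilibriumManifold, endowments, IsEquilibrium, Set.mem_ofPred_eq, Fin.sum_univ_two,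
    Fin.forall_fin_two]
  constructor
  · rintro ⟨hp, hω, x, ⟨h0, h1⟩, hx⟩
    rw [(hu 0).isDemand_iff hp] at h0
    rw [(hu 1).isDemand_iff hp] at h1
    refine ⟨by rw [← hω]; abel, x 0, ?_, h0.2, h0.1.symm⟩
    rw [paretoSet, Set.mem_ofPred_eq, h0.2, show r - x 0 = x 1 by rw [← hω, ← hx]; abel, h1.2]
  · rintro ⟨hω, x, hx, rfl, h⟩
    have hp := (hu 0).supportPrice_mem x
    refine ⟨hp, by rw [hω]; abel, ![x, r - x], ⟨?_, ?_⟩, by simp [hω]⟩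
    · exact ((hu 0).isDemand_iff hp _).2 ⟨h.symm, rfl⟩
    · refine ((hu 1).isDemand_iff hp _).2 ⟨?_, hx.symm⟩
      simp [hω, dotProduct_sub, h]

/-- Equilibrium is unique for all endowments iff the price is constant on the Pareto set. -/
theorem existsUnique_iff :
    (∀ ω ∈ endowments 2 r, ∃! p, (p, ω) ∈ equilibriumManifold u r) ↔
      ∀ x ∈ paretoSet u r, ∀ y ∈ paretoSet u r,
        supportPrice (u 0) x = supportPrice (u 0) y := by
  constructor
  · intro h x hx y hy
    by_contra hne
    obtain ⟨i, hi⟩ := Function.ne_iff.1 hne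
    set p := supportPrice (u 0) x with hp
    set q := supportPrice (u 0) y with hq
    have hpn : p (Fin.last n) = 1 := ((hu 0).supportPrice_mem x).2
    have hqn : q (Fin.last n) = 1 := ((hu 0).supportPrice_mem y).2
    have hd : p i - q i ≠ 0 := sub_ne_zero.2 hi
    -- A common point `z` of the two budget hyperplanes is sought using only good `i` and the
    -- numéraire: both numéraire prices are 1, so subtracting the equations determines the amount of
    -- good `i`.
    let α := (p ⬝ᵥ x - q ⬝ᵥ y) / (p i - q i)
    let z : Fin (n + 1) → ℝ := Pi.single i α + Pi.single (Fin.last n) (p ⬝ᵥ x - α * p i)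
    have hα : α * (p i - q i) = p ⬝ᵥ x - q ⬝ᵥ y := div_mul_cancel₀ _ hd
    have hz1 : p ⬝ᵥ z = p ⬝ᵥ x := by
      simp only [z, dotProduct_add, dotProduct_single, hpn]; ring
    have hz2 : q ⬝ᵥ z = q ⬝ᵥ y := by
      simp only [z, dotProduct_add, dotProduct_single, hqn]; linear_combination -hα
    have hω : (![z, r - z] : Fin 2 → Fin (n + 1) → ℝ) ∈ endowments 2 r := by
      simp [endowments]
    refine hne ((h _ hω).unique ?_ ?_)
    · exact (mem_equilibriumManifold_iff hu _ _).2 ⟨rfl, x, hx, rfl, hz1⟩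
    · exact (mem_equilibriumManifold_iff hu _ _).2 ⟨rfl, y, hy, rfl, hz2⟩
  · intro h ω hω
    have hω' : ω 1 = r - ω 0 := by
      have h2 : ∑ i, ω i = r := hω
      rw [← h2, Fin.sum_univ_two]; abel
    obtain ⟨y, hy, -⟩ := exists_mem_paretoSet hu (r := r) r
    set p := supportPrice (u 0) y with hp
    obtain ⟨x, hx, hxp⟩ := (hu 0).exists_demand ((hu 0).supportPrice_mem y) (p ⬝ᵥ ω 0)
    obtain ⟨x', hx', hxx'⟩ := exists_mem_paretoSet hu (r := r) x
    -- Demand at the common price `p` is itself Pareto: the Pareto bundle of equal utility has the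
    -- same supporting price, hence is the same bundle.
    have heq : x' = x := (hu 0).eq_of_supportPrice_eq ((h x' hx' y hy).trans hxp.symm) hxx'
    refine ⟨p, (mem_equilibriumManifold_iff hu _ _).2 ⟨hω', x, heq ▸ hx', hxp, hx.symm⟩, ?_⟩
    intro q hq
    obtain ⟨-, z, hz, rfl, -⟩ := (mem_equilibriumManifold_iff hu _ _).1 hq
    exact h z hz y hy

end Exchange

/-! ### Smoothness of demand and of the Pareto curve -/

open Filter Topology

theorem ContDiff.exists_local_rightInverse {A B : Type*} [NormedAddCommGroup A] [NormedSpace ℝ A]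
    [FiniteDimensional ℝ A] [NormedAddCommGroup B] [NormedSpace ℝ B] [FiniteDimensional ℝ B]
    {G : A → B} (hG : ContDiff ℝ (⊤ : ℕ∞) G) {a : A}
    (hinj : ∀ v, fderiv ℝ G a v = 0 → v = 0)
    (hfin : Module.finrank ℝ A = Module.finrank ℝ B) :
    ∃ g : B → A, ContDiffAt ℝ (⊤ : ℕ∞) g (G a) ∧ ∀ᶠ y in 𝓝 (G a), G (g y) = y := by
  have : CompleteSpace A := FiniteDimensional.complete ℝ A
  let e : A ≃L[ℝ] B := (LinearEquiv.ofInjectiveOfFinrankEq (fderiv ℝ G a).toLinearMap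
    ((injective_iff_map_eq_zero _).2 hinj) hfin).toContinuousLinearEquiv
  have he : HasFDerivAt G (e : A →L[ℝ] B) a :=
    ((hG.differentiable (by simp)) a).hasFDerivAt
  have hn : ((⊤ : ℕ∞) : WithTop ℕ∞) ≠ 0 := by simp
  exact ⟨hG.contDiffAt.localInverse he hn, hG.contDiffAt.to_localInverse he hn,
    (hG.contDiffAt.hasStrictFDerivAt' he hn).eventually_right_inverse⟩

theorem HasFDerivAt.dotProduct_apply {A ι : Type*} [NormedAddCommGroup A] [NormedSpace ℝ A]
    [Fintype ι] {f g : A → ι → ℝ} {f' g' : A →L[ℝ] ι → ℝ} {a : A} (hf : HasFDerivAt f f' a)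
    (hg : HasFDerivAt g g' a) (v : A) :
    fderiv ℝ (fun x => f x ⬝ᵥ g x) a v = f' v ⬝ᵥ g a + f a ⬝ᵥ g' v := by
  have h := HasFDerivAt.fun_sum (u := Finset.univ) fun i _ =>
    (hasFDerivAt_pi'.1 hf i).mul (hasFDerivAt_pi'.1 hg i)
  have h' : HasFDerivAt (fun x => f x ⬝ᵥ g x) _ a := h
  rw [h'.fderiv]
  simp only [sum_apply, dotProduct, ← Finset.sum_add_distrib]
  refine Finset.sum_congr rfl fun i _ => ?_
  simp
  ring

namespace Exchange

variable {n : ℕ}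

/-- The budget line at which the bundle `x` is demanded: non-numéraire prices, and income. -/
noncomputable def supportBudget (u : (Fin (n + 1) → ℝ) → ℝ) (x : Fin (n + 1) → ℝ) :
    (Fin n → ℝ) × ℝ :=
  (fun i => supportPrice u x i.castSucc, supportPrice u x ⬝ᵥ x)

namespace IsSmoothUtility

variable {u : (Fin (n + 1) → ℝ) → ℝ} (hu : IsSmoothUtility u)

include hu

theorem contDiff_supportBudget : ContDiff ℝ (⊤ : ℕ∞) (supportBudget u) := by
  have h := contDiff_pi.1 hu.contDiff_supportPrice
  refine (contDiff_pi.2 fun i => h _).prodMk (ContDiff.sum fun i _ => (h i).mul ?_)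
  exact contDiff_apply ℝ ℝ i

theorem supportPrice_ext {x y : Fin (n + 1) → ℝ}
    (h : ∀ i : Fin n, supportPrice u x i.castSucc = supportPrice u y i.castSucc) :
    supportPrice u x = supportPrice u y := by
  ext l
  induction l using Fin.lastCases with
  | last => rw [(hu.supportPrice_mem x).2, (hu.supportPrice_mem y).2]
  | cast i => exact h i

theorem supportBudget_injective : Function.Injective (supportBudget u) := by
  intro x y h
  have h1 := hu.supportPrice_ext fun i => congrFun (congrArg Prod.fst h) i
  have h2 : supportPrice u x ⬝ᵥ x = supportPrice u y ⬝ᵥ y := congrArg Prod.snd h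
  by_contra hne
  have h3 := hu.lt_of_dotProduct_le hne (by rw [← h2, h1])
  have h4 := hu.lt_of_dotProduct_le (Ne.symm hne) (by rw [h2, h1])
  exact lt_asymm h3 h4

/-- If price and income are stationary in the direction `v`, then `p ⬝ᵥ v = 0`, so `Du v = 0`.
Differentiating `Du v = ∂_last u * (p ⬝ᵥ v)` along `v` then gives `D²u(v, v) = 0`, so `quasiconcave`
forces `v = 0`. -/
theorem fderiv_supportBudget_injective {x v : Fin (n + 1) → ℝ}
    (h : fderiv ℝ (supportBudget u) x v = 0) : v = 0 := by
  have hd : DifferentiableAt ℝ (supportPrice u) x :=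
    hu.contDiff_supportPrice.differentiable (by simp) x
  have hi := fun l => hasFDerivAt_pi'.1 hd.hasFDerivAt l
  have hB : DifferentiableAt ℝ (supportBudget u) x :=
    hu.contDiff_supportBudget.differentiable (by simp) x
  have hp : fderiv ℝ (supportPrice u) x v = 0 := by
    ext l
    induction l using Fin.lastCases with
    | last =>
      have h1 : (fun y => supportPrice u y (Fin.last n)) = fun _ => 1 :=
        funext fun y => (hu.supportPrice_mem y).2
      have := (hi (Fin.last n)).fderiv
      rw [h1, fderiv_fun_const] at this
      exact (congrArg (fun T : (Fin (n + 1) → ℝ) →L[ℝ] ℝ => T v) this).symm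
    | cast i =>
      have h1 := (hasFDerivAt_pi'.1 hB.hasFDerivAt.fst i).unique (hi i.castSucc)
      have h2 := congrArg (fun T : (Fin (n + 1) → ℝ) →L[ℝ] ℝ => T v) h1
      simp only [ContinuousLinearMap.comp_apply, h] at h2
      simpa using h2.symm
  have hw : supportPrice u x ⬝ᵥ v = 0 := by
    have h1 := hB.hasFDerivAt.snd.fderiv
    have h2 := hd.hasFDerivAt.dotProduct_apply (hasFDerivAt_id x) v
    have h3 := congrArg (fun T : (Fin (n + 1) → ℝ) →L[ℝ] ℝ => T v) h1
    simp only [ContinuousLinearMap.comp_apply, h] at h3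
    simp only [hp, zero_dotProduct, zero_add, id_eq] at h2
    exact h2.symm.trans h3
  have hDu : fderiv ℝ u x v = 0 := by rw [hu.fderiv_apply_eq, hw, mul_zero]
  by_contra hv
  have hD2 : DifferentiableAt ℝ (fderiv ℝ u) x := hu.contDiff_fderiv.differentiable (by simp) x
  have hl : ∀ a, HasFDerivAt (fun y => fderiv ℝ u y a) ((fderiv ℝ (fderiv ℝ u) x).flip a) x :=
    fun a => by simpa using hD2.hasFDerivAt.clm_apply (hasFDerivAt_const a x)
  have hdot : DifferentiableAt ℝ (fun y => supportPrice u y ⬝ᵥ v) x :=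
    DifferentiableAt.fun_sum fun l _ => (hi l).differentiableAt.mul_const _
  have e1 : (fun y => fderiv ℝ u y v)
      = fun y => fderiv ℝ u y (Pi.single (Fin.last n) 1) * (supportPrice u y ⬝ᵥ v) :=
    funext fun y => hu.fderiv_apply_eq y v
  have e2 : fderiv ℝ (fun y => supportPrice u y ⬝ᵥ v) x v = 0 := by
    rw [hd.hasFDerivAt.dotProduct_apply (hasFDerivAt_const v x) v, hp]
    simp
  have e3 := congrArg (fun T : (Fin (n + 1) → ℝ) →L[ℝ] ℝ => T v) (hl v).fderiv
  rw [e1, fderiv_fun_mul (hl _).differentiableAt hdot] at e3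
  simp only [smul_apply, e2, hw, smul_zero, zero_smul, add_zero,
    ContinuousLinearMap.flip_apply] at e3
  exact (hu.quasiconcave x v hv hDu).ne e3.symm

/-- Demand as a function of non-numéraire prices and income is smooth. -/
theorem contDiffAt_invFun_supportBudget (x : Fin (n + 1) → ℝ) :
    ContDiffAt ℝ (⊤ : ℕ∞) (Function.invFun (supportBudget u)) (supportBudget u x) := by
  obtain ⟨g, hg, hr⟩ := hu.contDiff_supportBudget.exists_local_rightInverse (a := x)
    (fun v => hu.fderiv_supportBudget_injective) (by simp)
  refine hg.congr_of_eventuallyEq ?_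
  filter_upwards [hr] with y hy
  -- `supportBudget` is globally injective, so its chosen inverse coincides near the point with the
  -- smooth local one.
  conv_lhs => rw [← hy]
  exact Function.leftInverse_invFun hu.supportBudget_injective _

end IsSmoothUtility

variable {u : Fin 2 → (Fin (n + 1) → ℝ) → ℝ} (hu : ∀ i, IsSmoothUtility (u i))
  {r : Fin (n + 1) → ℝ}

include hu

/-- The multiplier form gives as many equations as unknowns `(x, μ)` once the utility level is
fixed, as the inverse function theorem requires. -/
theorem mem_paretoSet_iff {x : Fin (n + 1) → ℝ} :
    x ∈ paretoSet u r ↔ ∃ μ : ℝ, fderiv ℝ (u 0) x = μ • fderiv ℝ (u 1) (r - x) := by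
  have h0 := (hu 0).monotone x (Fin.last n)
  have h1 := (hu 1).monotone (r - x) (Fin.last n)
  constructor
  · intro hx
    refine ⟨fderiv ℝ (u 0) x (Pi.single (Fin.last n) 1) /
      fderiv ℝ (u 1) (r - x) (Pi.single (Fin.last n) 1), ContinuousLinearMap.ext fun h => ?_⟩
    rw [smul_apply, (hu 0).fderiv_apply_eq x h, (hu 1).fderiv_apply_eq (r - x) h,
      show supportPrice (u 0) x = supportPrice (u 1) (r - x) from hx, smul_eq_mul, ← mul_assoc,
      div_mul_cancel₀ _ h1.ne']
  · rintro ⟨μ, h⟩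
    have hμ : μ ≠ 0 := by
      rintro rfl
      simp [h] at h0
    ext l
    simp only [supportPrice, h, smul_apply, smul_eq_mul]
    exact mul_div_mul_left _ _ hμ

/-- The Pareto set is locally the graph of a smooth curve over the utility of the first consumer. -/
theorem exists_local_paretoCurve {x : Fin (n + 1) → ℝ} (hx : x ∈ paretoSet u r) :
    ∃ Y : ℝ → Fin (n + 1) → ℝ, ContDiffAt ℝ (⊤ : ℕ∞) Y (u 0 x) ∧
      ∀ᶠ t in 𝓝 (u 0 x), Y t ∈ paretoSet u r ∧ u 0 (Y t) = t := by
  obtain ⟨μ, hμ⟩ := (mem_paretoSet_iff hu).1 hx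
  have hμ0 : 0 < μ := by
    have h0 := (hu 0).monotone x (Fin.last n)
    rw [hμ, smul_apply, smul_eq_mul] at h0
    exact pos_of_mul_pos_left h0 ((hu 1).monotone (r - x) (Fin.last n)).le
  let G : (Fin (n + 1) → ℝ) × ℝ → ((Fin (n + 1) → ℝ) →L[ℝ] ℝ) × ℝ :=
    fun z => (fderiv ℝ (u 0) z.1 - z.2 • fderiv ℝ (u 1) (r - z.1), u 0 z.1)
  have hGx : G (x, μ) = (0, u 0 x) := by simp [G, hμ]
  have hG : ContDiff ℝ (⊤ : ℕ∞) G := by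
    refine ContDiff.prodMk (((hu 0).contDiff_fderiv.comp contDiff_fst).sub
      (contDiff_snd.smul ((hu 1).contDiff_fderiv.comp ?_))) ((hu 0).smooth.comp contDiff_fst)
    exact contDiff_const.sub contDiff_fst
  have hd0 : DifferentiableAt ℝ (fderiv ℝ (u 0)) x :=
    (hu 0).contDiff_fderiv.differentiable (by simp) x
  have hd1 : DifferentiableAt ℝ (fderiv ℝ (u 1)) (r - x) :=
    (hu 1).contDiff_fderiv.differentiable (by simp) _
  have hfst : HasFDerivAt (Prod.fst : (Fin (n + 1) → ℝ) × ℝ → _)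
    (ContinuousLinearMap.fst ℝ _ ℝ) (x, μ) := hasFDerivAt_fst
  have hGd : HasFDerivAt G _ (x, μ) :=
    ((hd0.hasFDerivAt.comp (x, μ) hfst).sub ((hasFDerivAt_snd (p := (x, μ))).smul
      (hd1.hasFDerivAt.comp (x, μ) (hfst.const_sub r)))).prodMk
      (((hu 0).differentiableAt x).hasFDerivAt.comp (x, μ) hfst)
  obtain ⟨g, hg, hr⟩ := hG.exists_local_rightInverse (a := (x, μ)) (by
      rintro ⟨v, ν⟩ hv
      rw [hGd.fderiv] at hv
      obtain ⟨hv1, hv2⟩ := Prod.mk.inj hv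
      have hv2' : fderiv ℝ (u 0) x v = 0 := hv2
      have hv3 : fderiv ℝ (u 1) (r - x) v = 0 := by
        rw [hμ, smul_apply, smul_eq_mul] at hv2'
        exact (mul_eq_zero.1 hv2').resolve_left hμ0.ne'
      have hv4 : ∀ h, fderiv ℝ (fderiv ℝ (u 0)) x v h
          + μ * fderiv ℝ (fderiv ℝ (u 1)) (r - x) v h - ν * fderiv ℝ (u 1) (r - x) h = 0 := by
        intro h
        have := congrArg (fun T : (Fin (n + 1) → ℝ) →L[ℝ] ℝ => T h) hv1
        simp at this
        linarith
      -- Evaluating the linearized condition at `v` itself removes the multiplier term and leaves a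
      -- sum of two negative quantities equal to zero.
      have hv0 : v = 0 := by
        by_contra hne
        have h1 := (hu 0).quasiconcave x v hne hv2'
        have h2 := (hu 1).quasiconcave (r - x) v hne hv3
        have h3 := hv4 v
        rw [hv3] at h3
        nlinarith
      subst hv0
      have h5 := hv4 (Pi.single (Fin.last n) 1)
      simp only [map_zero, zero_apply, mul_zero, add_zero, zero_sub, neg_eq_zero, mul_eq_zero,
        ((hu 1).monotone (r - x) (Fin.last n)).ne', or_false] at h5
      rw [h5]; rfl)
    (by
      rw [Module.finrank_prod, Module.finrank_prod,
        ← (LinearMap.toContinuousLinearMap (𝕜 := ℝ) (E := Fin (n + 1) → ℝ)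
          (F' := ℝ)).finrank_eq, Module.finrank_linearMap]
      simp)
  rw [hGx] at hg hr
  have hc : ContDiff ℝ (⊤ : ℕ∞) fun t : ℝ => ((0 : (Fin (n + 1) → ℝ) →L[ℝ] ℝ), t) :=
    contDiff_const.prodMk contDiff_id
  refine ⟨fun t => (g (0, t)).1, (hg.comp (u 0 x) hc.contDiffAt).fst, ?_⟩
  have ht : Tendsto (fun t : ℝ => ((0 : (Fin (n + 1) → ℝ) →L[ℝ] ℝ), t)) (𝓝 (u 0 x))
    (𝓝 (0, u 0 x)) := hc.continuous.tendsto _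
  filter_upwards [ht.eventually hr] with t ht
  obtain ⟨h1, h2⟩ := Prod.mk.inj ht
  exact ⟨(mem_paretoSet_iff hu).2 ⟨_, sub_eq_zero.1 h1⟩, h2⟩

/-- The global parametrization of the Pareto set by the utility of the first consumer. -/
theorem exists_paretoCurve (r : Fin (n + 1) → ℝ) :
    ∃ X : ℝ → Fin (n + 1) → ℝ, ∀ t ∈ Set.range (u 0),
      X t ∈ paretoSet u r ∧ u 0 (X t) = t ∧ ContDiffAt ℝ (⊤ : ℕ∞) X t := by
  have h : ∀ t, ∃ y, t ∈ Set.range (u 0) → y ∈ paretoSet u r ∧ u 0 y = t := by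
    intro t
    by_cases ht : t ∈ Set.range (u 0)
    · obtain ⟨x₀, rfl⟩ := ht
      obtain ⟨x, hx⟩ := exists_mem_paretoSet hu (r := r) x₀
      exact ⟨x, fun _ => hx⟩
    · exact ⟨0, fun h => absurd h ht⟩
  choose X hX using h
  refine ⟨X, fun t ht => ⟨(hX t ht).1, (hX t ht).2, ?_⟩⟩
  obtain ⟨Y, hY, hYe⟩ := exists_local_paretoCurve hu (hX t ht).1
  rw [(hX t ht).2] at hY hYe
  refine hY.congr_of_eventuallyEq ?_
  filter_upwards [hYe] with s hs
  have hs' := hX s ⟨Y s, hs.2⟩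
  -- Each utility level has one Pareto bundle, so the pointwise choice `X` agrees with the smooth
  -- local curve `Y`.
  exact paretoSet_injOn hu hs'.1 hs.1 (hs'.2.trans hs.2.symm)

omit hu in
theorem IsSmoothUtility.isOpen_range {u : (Fin (n + 1) → ℝ) → ℝ} (hu : IsSmoothUtility u) :
    IsOpen (Set.range u) := by
  rw [isOpen_iff_mem_nhds]
  rintro _ ⟨x, rfl⟩
  have hs : HasStrictFDerivAt u (fderiv ℝ u x) x :=
    hu.smooth.contDiffAt.hasStrictFDerivAt (by simp)
  rw [← hs.map_nhds_eq_of_surj]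
  · exact Filter.range_mem_map
  · refine LinearMap.range_eq_top.2 (LinearMap.surjective fun h => ?_)
    have := hu.monotone x (Fin.last n)
    rw [show fderiv ℝ u x (Pi.single (Fin.last n) 1) = 0 from
      congrArg (fun T : (Fin (n + 1) → ℝ) →ₗ[ℝ] ℝ => T (Pi.single (Fin.last n) 1)) h] at this
    exact lt_irrefl _ this

end Exchange

/-! ### Flatness inside a parallel affine subspace -/

namespace Embedded

variable {m : ℕ} {ι : Type*} [Fintype ι]

theorem partialDeriv_euclidean_apply {Φ : (Fin m → ℝ) → EuclideanSpace ℝ ι} {x : Fin m → ℝ}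
    (h : DifferentiableAt ℝ Φ x) (i : Fin m) (k : ι) :
    partialDeriv i Φ x k = partialDeriv i (fun y => Φ y k) x := by
  have := ((EuclideanSpace.proj (𝕜 := ℝ) k :
    EuclideanSpace ℝ ι →L[ℝ] ℝ).hasFDerivAt.comp x h.hasFDerivAt).fderiv
  exact (congrArg (fun T : (Fin m → ℝ) →L[ℝ] ℝ => T (Pi.single i 1)) this).symm

theorem partialDeriv_eq_of_hasDerivAt {f : (Fin m → ℝ) → ℝ} {x : Fin m → ℝ}
    (hf : DifferentiableAt ℝ f x) {i : Fin m} {f' : ℝ}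
    (h : HasDerivAt (fun s : ℝ => f (x + s • Pi.single i 1)) f' 0) :
    partialDeriv i f x = f' := by
  have hl : HasDerivAt (fun s : ℝ => x + s • (Pi.single i 1 : Fin m → ℝ)) (Pi.single i 1) 0 := by
    simpa using ((hasDerivAt_id (0 : ℝ)).smul_const (Pi.single i (1 : ℝ) : Fin m → ℝ)).const_add x
  have hf' : HasFDerivAt f (fderiv ℝ f x) (x + (0 : ℝ) • (Pi.single i 1 : Fin m → ℝ)) := by
    simpa using hf.hasFDerivAt
  exact (hf'.comp_hasDerivAt 0 hl).unique h

/-- A submanifold contained in a parallel affine subspace of the same dimension is flat. -/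
theorem hasZeroCurvature_of_coords_const {E : Set (EuclideanSpace ℝ (ι ⊕ Fin m))} {q : ι → ℝ}
    (hE : ∀ v ∈ E, ∀ i, v (Sum.inl i) = q i) : HasZeroCurvature m E := by
  intro U Φ hΦ x hx a b _
  obtain ⟨hmaps, -⟩ := hΦ.embedding
  have hU := hΦ.isOpen
  have hd1 := contDiffOn_partialDeriv hU hΦ.smooth
  have h1 : ∀ y ∈ U, ∀ l i, partialDeriv l Φ y (Sum.inl i) = 0 := by
    intro y hy l i
    rw [partialDeriv_euclidean_apply (differentiableAt_of_contDiffOn hU hΦ.smooth hy),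
      partialDeriv_congr hU hy (g := fun _ => q i) fun z hz => hE _ (hmaps hz) i]
    simp [partialDeriv]
  have h2 : ∀ k l i, partialDeriv k (partialDeriv l Φ) x (Sum.inl i) = 0 := by
    intro k l i
    rw [partialDeriv_euclidean_apply (differentiableAt_of_contDiffOn hU (hd1 l) hx),
      partialDeriv_congr hU hx (g := fun _ => (0 : ℝ)) fun z hz => h1 z hz l i]
    simp [partialDeriv]
  have hA : ∀ c : Fin m → ℝ, fderiv ℝ Φ x c = ∑ l, c l • partialDeriv l Φ x := by
    intro c
    conv_lhs => rw [pi_eq_sum_univ' c]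
    rw [map_sum]
    exact Finset.sum_congr rfl fun i _ => by rw [map_smul, partialDeriv]
  have hA0 : ∀ c i, fderiv ℝ Φ x c (Sum.inl i) = 0 := by
    intro c i
    simp [hA, h1 x hx]
  -- The tangent map followed by the projection to the last `m` coordinates is injective and square,
  -- hence onto: every vector with zero `inl` part is tangent. The second form is then both tangent
  -- and normal, so it vanishes.
  let T : (Fin m → ℝ) →ₗ[ℝ] (Fin m → ℝ) :=
    { toFun := fun c k => fderiv ℝ Φ x c (Sum.inr k)
      map_add' := fun c d => by ext; simp
      map_smul' := fun c d => by ext; simp }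
  have hT : Function.Injective T := by
    rw [injective_iff_map_eq_zero]
    intro c hc
    refine (injective_iff_map_eq_zero _).1 (hΦ.immersion x hx) c ?_
    ext k
    rcases k with i | k
    · exact hA0 c i
    · exact congrFun hc k
  have hII : ∀ i j, secondForm Φ i j x = 0 := by
    intro i j
    obtain ⟨c, hc⟩ := LinearMap.injective_iff_surjective.1 hT
      fun k => secondForm Φ i j x (Sum.inr k)
    have hc' : secondForm Φ i j x = fderiv ℝ Φ x c := by
      ext k
      rcases k with k | k
      · rw [hA0]
        simp [secondForm, h2, h1 x hx]
      · exact (congrFun hc k).symm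
    have h3 : inner ℝ (secondForm Φ i j x) (fderiv ℝ Φ x c) = 0 := by
      rw [hA, inner_sum]
      refine Finset.sum_eq_zero fun l _ => ?_
      rw [inner_smul_right, inner_secondForm hU hΦ.smooth (hΦ.immersion x hx) hx, mul_zero]
    rw [← hc'] at h3
    exact inner_self_eq_zero.1 h3
  have hc : curvatureForm Φ x a b = 0 := by
    simp [curvatureForm, sum_riemann_mul_metric hU hΦ.smooth hΦ.immersion hx, hII]
  rw [sectionalCurvature, hc, zero_div]

end Embedded

/-! ### Ruled parametrizations and their curvature -/

namespace Exchange

open Embedded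

variable {n : ℕ}

/-- The equilibrium manifold of a two-consumer economy is ruled over a curve `(P, X)` of supporting
prices and bundles: the parameters are the endowments of the first consumer in all goods but the
numéraire, and the parameter of the curve. -/
noncomputable def ruledParam (P X : ℝ → Fin (n + 1) → ℝ) (z : Fin (n + 1) → ℝ) :
    EuclideanSpace ℝ (Fin n ⊕ Fin (n + 1)) :=
  WithLp.toLp 2 (Sum.elim (fun i => P (z (Fin.last n)) i.castSucc)
    (z + Pi.single (Fin.last n) (P (z (Fin.last n)) ⬝ᵥ (X (z (Fin.last n)) - z))))

section ruledParam

variable {P X : ℝ → Fin (n + 1) → ℝ}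

theorem ruledParam_inl (z : Fin (n + 1) → ℝ) (i : Fin n) :
    ruledParam P X z (Sum.inl i) = P (z (Fin.last n)) i.castSucc := rfl

theorem ruledParam_castSucc (z : Fin (n + 1) → ℝ) (i : Fin n) :
    ruledParam P X z (Sum.inr i.castSucc) = z i.castSucc := by
  simp [ruledParam, Fin.castSucc_ne_last]

/-- The entry `z (Fin.last n)` is only the curve parameter. When the last price is 1 it cancels
against its own term in the dot product, and the numéraire endowment is what the budget equation
dictates. -/
theorem ruledParam_last (z : Fin (n + 1) → ℝ) :
    ruledParam P X z (Sum.inr (Fin.last n))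
      = z (Fin.last n) + P (z (Fin.last n)) ⬝ᵥ (X (z (Fin.last n)) - z) := by
  simp [ruledParam]

theorem contDiffOn_ruledParam {I : Set ℝ} (hP : ∀ t ∈ I, ContDiffAt ℝ (⊤ : ℕ∞) P t)
    (hX : ∀ t ∈ I, ContDiffAt ℝ (⊤ : ℕ∞) X t) :
    ContDiffOn ℝ (⊤ : ℕ∞) (ruledParam P X) {z | z (Fin.last n) ∈ I} := by
  intro z hz
  refine ContDiffAt.contDiffWithinAt (contDiffAt_euclidean.2 ?_)
  have hev : ∀ l, ContDiffAt ℝ (⊤ : ℕ∞) (fun z : Fin (n + 1) → ℝ => z l) z := fun l =>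
    (contDiff_apply ℝ ℝ l).contDiffAt
  have hPz : ∀ l, ContDiffAt ℝ (⊤ : ℕ∞) (fun z : Fin (n + 1) → ℝ => P (z (Fin.last n)) l) z :=
    contDiffAt_pi.1 ((hP _ hz).comp z (hev (Fin.last n)))
  have hXz : ∀ l, ContDiffAt ℝ (⊤ : ℕ∞) (fun z : Fin (n + 1) → ℝ => X (z (Fin.last n)) l) z :=
    contDiffAt_pi.1 ((hX _ hz).comp z (hev (Fin.last n)))
  rintro (i | l)
  · exact hPz i.castSucc
  · induction l using Fin.lastCases with
    | last =>
      simp only [ruledParam_last]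
      exact (hev _).add (ContDiffAt.sum fun l _ => (hPz l).mul ((hXz l).sub (hev l)))
    | cast i =>
      simp only [ruledParam_castSucc]
      exact hev _

variable {I : Set ℝ}

/-- With the curve parameter fixed the map is affine: good `i` is exchanged for the numéraire at
price `Pᵢ`. -/
theorem partialDeriv_castSucc_ruledParam (hI : IsOpen I)
    (hP : ∀ t ∈ I, ContDiffAt ℝ (⊤ : ℕ∞) P t) (hX : ∀ t ∈ I, ContDiffAt ℝ (⊤ : ℕ∞) X t)
    {z : Fin (n + 1) → ℝ} (hz : z (Fin.last n) ∈ I) (i : Fin n) :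
    partialDeriv i.castSucc (ruledParam P X) z
      = WithLp.toLp 2 (Sum.elim (0 : Fin n → ℝ) (Pi.single i.castSucc 1
          - Pi.single (Fin.last n) (P (z (Fin.last n)) i.castSucc))) := by
  have hU : IsOpen {z : Fin (n + 1) → ℝ | z (Fin.last n) ∈ I} :=
    hI.preimage (continuous_apply (Fin.last n))
  have hd := differentiableAt_of_contDiffOn hU (contDiffOn_ruledParam hP hX) hz
  have hdk := differentiableAt_euclidean.1 hd
  have hne : Fin.last n ≠ i.castSucc := (Fin.castSucc_ne_last i).symm
  ext k
  rw [partialDeriv_euclidean_apply hd]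
  refine partialDeriv_eq_of_hasDerivAt (hdk k) ?_
  rcases k with j | l
  · simpa [ruledParam_inl, hne] using hasDerivAt_const (0 : ℝ) (P (z (Fin.last n)) j.castSucc)
  · induction l using Fin.lastCases with
    | last =>
      simp only [ruledParam_last]
      have h1 : (fun s : ℝ => (z + s • (Pi.single i.castSucc 1 : Fin (n + 1) → ℝ)) (Fin.last n)
          + P ((z + s • (Pi.single i.castSucc 1 : Fin (n + 1) → ℝ)) (Fin.last n)) ⬝ᵥ
            (X ((z + s • (Pi.single i.castSucc 1 : Fin (n + 1) → ℝ)) (Fin.last n))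
              - (z + s • (Pi.single i.castSucc 1 : Fin (n + 1) → ℝ))))
          = fun s => (z (Fin.last n) + P (z (Fin.last n)) ⬝ᵥ (X (z (Fin.last n)) - z))
            - s * P (z (Fin.last n)) i.castSucc := by
        ext s
        simp [hne, dotProduct_sub, dotProduct_add]
        ring
      rw [h1]
      simpa [hne] using ((hasDerivAt_id (0 : ℝ)).mul_const
        (P (z (Fin.last n)) i.castSucc)).const_sub
          (z (Fin.last n) + P (z (Fin.last n)) ⬝ᵥ (X (z (Fin.last n)) - z))
    | cast j =>
      simp only [ruledParam_castSucc]
      simpa [hne] using ((hasDerivAt_id (0 : ℝ)).mul_const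
        ((Pi.single i.castSucc 1 : Fin (n + 1) → ℝ) j.castSucc)).const_add (z j.castSucc)

/-- The numéraire coordinate of this derivative is left out because the curvature argument does not
need it. -/
theorem partialDeriv_last_ruledParam (hI : IsOpen I)
    (hP : ∀ t ∈ I, ContDiffAt ℝ (⊤ : ℕ∞) P t) (hX : ∀ t ∈ I, ContDiffAt ℝ (⊤ : ℕ∞) X t)
    {z : Fin (n + 1) → ℝ} (hz : z (Fin.last n) ∈ I) (i : Fin n) :
    partialDeriv (Fin.last n) (ruledParam P X) z (Sum.inl i)
        = deriv (fun t => P t i.castSucc) (z (Fin.last n)) ∧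
      partialDeriv (Fin.last n) (ruledParam P X) z (Sum.inr i.castSucc) = 0 := by
  have hU : IsOpen {z : Fin (n + 1) → ℝ | z (Fin.last n) ∈ I} :=
    hI.preimage (continuous_apply (Fin.last n))
  have hd := differentiableAt_of_contDiffOn hU (contDiffOn_ruledParam hP hX) hz
  have hdk := differentiableAt_euclidean.1 hd
  rw [partialDeriv_euclidean_apply hd, partialDeriv_euclidean_apply hd]
  constructor
  · refine partialDeriv_eq_of_hasDerivAt (hdk _) ?_
    simp only [ruledParam_inl]
    have h1 : HasDerivAt (fun t => P t i.castSucc)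
        (deriv (fun t => P t i.castSucc) (z (Fin.last n))) (z (Fin.last n) + 0) := by
      rw [add_zero]
      exact ((contDiffAt_pi.1 (hP _ hz) i.castSucc).differentiableAt (by simp)).hasDerivAt
    simpa using h1.comp_const_add (z (Fin.last n)) 0
  · refine partialDeriv_eq_of_hasDerivAt (hdk _) ?_
    simp only [ruledParam_castSucc]
    simpa [Fin.castSucc_ne_last] using hasDerivAt_const (0 : ℝ) (z i.castSucc)

theorem partialDeriv_partialDeriv_castSucc_ruledParam (hI : IsOpen I)
    (hP : ∀ t ∈ I, ContDiffAt ℝ (⊤ : ℕ∞) P t) (hX : ∀ t ∈ I, ContDiffAt ℝ (⊤ : ℕ∞) X t)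
    {z : Fin (n + 1) → ℝ} (hz : z (Fin.last n) ∈ I) (i : Fin n) :
    partialDeriv i.castSucc (partialDeriv i.castSucc (ruledParam P X)) z = 0 ∧
    partialDeriv (Fin.last n) (partialDeriv i.castSucc (ruledParam P X)) z
      = WithLp.toLp 2 (Sum.elim (0 : Fin n → ℝ) (-Pi.single (Fin.last n)
          (deriv (fun t => P t i.castSucc) (z (Fin.last n))))) := by
  have hU : IsOpen {z : Fin (n + 1) → ℝ | z (Fin.last n) ∈ I} :=
    hI.preimage (continuous_apply (Fin.last n))
  have hd := differentiableAt_of_contDiffOn hU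
    (contDiffOn_partialDeriv hU (contDiffOn_ruledParam hP hX) i.castSucc) hz
  have hdk := differentiableAt_euclidean.1 hd
  have hne : Fin.last n ≠ i.castSucc := (Fin.castSucc_ne_last i).symm
  have hnear : ∀ j : Fin (n + 1), ∀ k, HasDerivAt (fun s : ℝ =>
      (WithLp.toLp 2 (Sum.elim (0 : Fin n → ℝ) (Pi.single i.castSucc 1
          - Pi.single (Fin.last n) (P ((z + s • (Pi.single j 1 : Fin (n + 1) → ℝ))
            (Fin.last n)) i.castSucc))) : EuclideanSpace ℝ (Fin n ⊕ Fin (n + 1))) k)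
        (partialDeriv j (partialDeriv i.castSucc (ruledParam P X)) z k) 0 := by
    intro j k
    have hl : HasDerivAt (fun s : ℝ => z + s • (Pi.single j 1 : Fin (n + 1) → ℝ))
        (Pi.single j 1) 0 := by
      simpa using ((hasDerivAt_id (0 : ℝ)).smul_const
        (Pi.single j (1 : ℝ) : Fin (n + 1) → ℝ)).const_add z
    have hf' : HasFDerivAt (fun y => partialDeriv i.castSucc (ruledParam P X) y k)
        (fderiv ℝ (fun y => partialDeriv i.castSucc (ruledParam P X) y k) z)
        (z + (0 : ℝ) • (Pi.single j 1 : Fin (n + 1) → ℝ)) := by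
      simpa using (hdk k).hasFDerivAt
    have h1 := hf'.comp_hasDerivAt 0 hl
    rw [partialDeriv_euclidean_apply hd]
    refine h1.congr_of_eventuallyEq ?_
    have hmem : ∀ᶠ s : ℝ in 𝓝 0, z + s • (Pi.single j 1 : Fin (n + 1) → ℝ) ∈
        {z : Fin (n + 1) → ℝ | z (Fin.last n) ∈ I} :=
      hl.continuousAt.eventually_mem (by simpa using hU.mem_nhds hz)
    filter_upwards [hmem] with s hs
    rw [Function.comp_apply, partialDeriv_castSucc_ruledParam hI hP hX hs i]
  constructor
  · ext k
    refine (hnear i.castSucc k).unique ?_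
    simp only [Pi.add_apply, Pi.smul_apply, Pi.single_eq_of_ne hne, smul_zero, add_zero]
    exact hasDerivAt_const _ _
  · ext k
    refine (hnear (Fin.last n) k).unique ?_
    rcases k with j | l
    · exact hasDerivAt_const _ _
    · induction l using Fin.lastCases with
      | last =>
        have h1 : HasDerivAt (fun t => P t i.castSucc)
            (deriv (fun t => P t i.castSucc) (z (Fin.last n))) (z (Fin.last n) + 0) := by
          rw [add_zero]
          exact ((contDiffAt_pi.1 (hP _ hz) i.castSucc).differentiableAt (by simp)).hasDerivAt
        simpa [hne] using (h1.comp_const_add (z (Fin.last n)) 0).fun_neg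
      | cast j =>
        simpa [Fin.castSucc_ne_last] using
          hasDerivAt_const (0 : ℝ) ((Pi.single i.castSucc 1 : Fin (n + 1) → ℝ) j.castSucc)

/-- Flatness of a ruled parametrization forces the direction of the rulings to be stationary. -/
theorem deriv_eq_zero_of_sectionalCurvature_eq_zero (hI : IsOpen I)
    (hP : ∀ t ∈ I, ContDiffAt ℝ (⊤ : ℕ∞) P t) (hX : ∀ t ∈ I, ContDiffAt ℝ (⊤ : ℕ∞) X t)
    (hinj : ∀ z : Fin (n + 1) → ℝ, z (Fin.last n) ∈ I →
      Function.Injective (fderiv ℝ (ruledParam P X) z))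
    {z : Fin (n + 1) → ℝ} (hz : z (Fin.last n) ∈ I)
    (hK : ∀ a b : Fin (n + 1) → ℝ, LinearIndependent ℝ ![a, b] →
      sectionalCurvature (ruledParam P X) z a b = 0) (i : Fin n) :
    deriv (fun t => P t i.castSucc) (z (Fin.last n)) = 0 := by
  have hU : IsOpen {z : Fin (n + 1) → ℝ | z (Fin.last n) ∈ I} :=
    hI.preimage (continuous_apply (Fin.last n))
  have hs := contDiffOn_ruledParam hP hX
  have hne : Fin.last n ≠ i.castSucc := (Fin.castSucc_ne_last i).symm
  obtain ⟨hii, hti⟩ := partialDeriv_partialDeriv_castSucc_ruledParam hI hP hX hz i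
  set Φ := ruledParam P X with hΦ
  have hli : LinearIndependent ℝ ![(Pi.single (Fin.last n) 1 : Fin (n + 1) → ℝ),
      Pi.single i.castSucc 1] := by
    rw [LinearIndependent.pair_iff]
    intro s t h
    have h1 := congrFun h (Fin.last n)
    have h2 := congrFun h i.castSucc
    simp [hne] at h1
    simp [hne.symm] at h2
    exact ⟨h1, h2⟩
  have hcurv : curvatureForm Φ z (Pi.single (Fin.last n) 1) (Pi.single i.castSucc 1) = 0 :=
    (div_eq_zero_iff.1 (hK _ _ hli)).resolve_right (metricForm_area_ne_zero (hinj z hz) hli)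
  have hit : partialDeriv i.castSucc (partialDeriv (Fin.last n) Φ) z
      = partialDeriv (Fin.last n) (partialDeriv i.castSucc Φ) z := partialDeriv_comm hU hs hz _ _
  -- Since `∂ᵢ∂ᵢΦ = 0`, the Gauss equation leaves only `-|II(∂ᵢ, ∂ₜ)|²`.
  have hII : secondForm Φ i.castSucc (Fin.last n) z = 0 := by
    rw [curvatureForm_single, sum_riemann_mul_metric hU hs hinj hz, hii, inner_zero_right,
      zero_sub, neg_eq_zero, ← hit] at hcurv
    have h1 : partialDeriv i.castSucc (partialDeriv (Fin.last n) Φ) z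
        = secondForm Φ i.castSucc (Fin.last n) z
          + ∑ l, christoffel Φ i.castSucc (Fin.last n) l z • partialDeriv l Φ z := by
      rw [secondForm, sub_add_cancel]
    rw [h1, inner_add_right, inner_sum] at hcurv
    simp only [inner_smul_right, inner_secondForm hU hs (hinj z hz) hz, mul_zero,
      Finset.sum_const_zero, add_zero] at hcurv
    exact inner_self_eq_zero.1 hcurv
  rw [secondForm, sub_eq_zero, hit, hti, Fin.sum_univ_castSucc] at hII
  set c := fun l => christoffel Φ i.castSucc (Fin.last n) l z
  have hk := fun k => congrArg (fun v : EuclideanSpace ℝ (Fin n ⊕ Fin (n + 1)) => v k) hII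
  simp only [hΦ, partialDeriv_castSucc_ruledParam hI hP hX hz] at hk
  have hlast := partialDeriv_last_ruledParam hI hP hX hz
  -- The vector `-Pᵢ' e_last` is now a tangent combination with coefficients `c`. In the endowment
  -- coordinate of good `j` only `∂ⱼΦ` is nonzero.
  have hc : ∀ j : Fin n, c j.castSucc = 0 := by
    intro j
    have := hk (Sum.inr j.castSucc)
    simp [(hlast j).2, Fin.castSucc_ne_last, Pi.single_apply] at this
    exact this.symm
  have h1 := hk (Sum.inl i)
  have h2 := hk (Sum.inr (Fin.last n))
  simp [(hlast i).1] at h1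
  -- The price coordinate `i` reads `0 = c_last * Pᵢ'`. If `c_last = 0`, the whole combination is
  -- zero and the numéraire coordinate gives `Pᵢ' = 0`.
  rcases h1 with h1 | h1
  · have hc' : ∀ j : Fin n, christoffel (ruledParam P X) i.castSucc (Fin.last n) j.castSucc z = 0 :=
      hc
    simpa [h1, hc'] using h2
  · exact h1

end ruledParam

theorem mem_euclideanEquilibriumManifold_iff {u : Fin 2 → (Fin (n + 1) → ℝ) → ℝ}
    (hu : ∀ i, IsSmoothUtility (u i)) {r : Fin (n + 1) → ℝ}
    (v : EuclideanSpace ℝ (Fin n ⊕ Fin (n + 1))) :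
    v ∈ euclideanEquilibriumManifold u r ↔ ∃ x ∈ paretoSet u r,
      (∀ i : Fin n, v (Sum.inl i) = supportPrice (u 0) x i.castSucc) ∧
      (supportPrice (u 0) x ⬝ᵥ fun l => v (Sum.inr l)) = supportPrice (u 0) x ⬝ᵥ x := by
  constructor
  · rintro ⟨⟨p, ω⟩, h, rfl⟩
    obtain ⟨-, x, hx, rfl, hx'⟩ := (mem_equilibriumManifold_iff hu _ _).1 h
    exact ⟨x, hx, fun i => rfl, hx'⟩
  · rintro ⟨x, hx, h1, h2⟩
    refine ⟨(supportPrice (u 0) x, ![fun l => v (Sum.inr l), r - fun l => v (Sum.inr l)]),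
      (mem_equilibriumManifold_iff hu _ _).2 ⟨rfl, x, hx, rfl, h2⟩, ?_⟩
    ext k
    rcases k with i | l
    · exact (h1 i).symm
    · rfl

/-- The budget of the first consumer at a point of `S × Ω(r)` in Euclidean coordinates. -/
noncomputable def budget (v : EuclideanSpace ℝ (Fin n ⊕ Fin (n + 1))) : (Fin n → ℝ) × ℝ :=
  (fun i => v (Sum.inl i),
    ∑ i : Fin n, v (Sum.inl i) * v (Sum.inr i.castSucc) + v (Sum.inr (Fin.last n)))

theorem contDiff_budget : ContDiff ℝ (⊤ : ℕ∞) (budget (n := n)) := by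
  have h : ∀ k, ContDiff ℝ (⊤ : ℕ∞) fun v : EuclideanSpace ℝ (Fin n ⊕ Fin (n + 1)) => v k :=
    contDiff_euclidean.1 contDiff_id
  exact (contDiff_pi.2 fun i => h _).prodMk
    ((ContDiff.sum fun i _ => (h (Sum.inl i)).mul (h (Sum.inr i.castSucc))).add (h _))

/-- The inverse of the global parametrization of the equilibrium manifold. -/
noncomputable def ruledCoords (u : (Fin (n + 1) → ℝ) → ℝ)
    (v : EuclideanSpace ℝ (Fin n ⊕ Fin (n + 1))) : Fin (n + 1) → ℝ :=
  Function.update (fun l => v (Sum.inr l)) (Fin.last n)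
    (u (Function.invFun (supportBudget u) (budget v)))

/-! ### Global parametrization of the equilibrium manifold -/

section Param

variable {u : Fin 2 → (Fin (n + 1) → ℝ) → ℝ} (hu : ∀ i, IsSmoothUtility (u i))
  {r : Fin (n + 1) → ℝ}

include hu

theorem budget_eq_supportBudget {v : EuclideanSpace ℝ (Fin n ⊕ Fin (n + 1))}
    {x : Fin (n + 1) → ℝ}
    (h1 : ∀ i : Fin n, v (Sum.inl i) = supportPrice (u 0) x i.castSucc)
    (h2 : (supportPrice (u 0) x ⬝ᵥ fun l => v (Sum.inr l)) = supportPrice (u 0) x ⬝ᵥ x) :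
    budget v = supportBudget (u 0) x := by
  refine Prod.ext (funext h1) ?_
  simp only [budget, supportBudget]
  rw [← h2, dotProduct, Fin.sum_univ_castSucc, ((hu 0).supportPrice_mem x).2, one_mul]
  simp only [h1]

/-- Smoothness holds in the ambient space, through the smooth inverse of `supportBudget`. It yields
both the continuity of the inverse chart and the immersion property. -/
theorem contDiffAt_ruledCoords {v : EuclideanSpace ℝ (Fin n ⊕ Fin (n + 1))}
    (hv : v ∈ euclideanEquilibriumManifold u r) :
    ContDiffAt ℝ (⊤ : ℕ∞) (ruledCoords (u 0)) v := by
  obtain ⟨x, -, h1, h2⟩ := (mem_euclideanEquilibriumManifold_iff hu v).1 hv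
  have hb := budget_eq_supportBudget hu h1 h2
  have hf := (hu 0).contDiffAt_invFun_supportBudget x
  rw [← hb] at hf
  have h : ∀ k, ContDiff ℝ (⊤ : ℕ∞) fun v : EuclideanSpace ℝ (Fin n ⊕ Fin (n + 1)) => v k :=
    contDiff_euclidean.1 contDiff_id
  refine contDiffAt_pi.2 fun l => ?_
  induction l using Fin.lastCases with
  | last =>
    simp only [ruledCoords, Function.update_self]
    exact (hu 0).smooth.contDiffAt.comp v (hf.comp v contDiff_budget.contDiffAt)
  | cast i =>
    simp only [ruledCoords, Function.update_of_ne (Fin.castSucc_ne_last i)]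
    exact (h _).contDiffAt

theorem ruledCoords_last {v : EuclideanSpace ℝ (Fin n ⊕ Fin (n + 1))} {x : Fin (n + 1) → ℝ}
    (h1 : ∀ i : Fin n, v (Sum.inl i) = supportPrice (u 0) x i.castSucc)
    (h2 : (supportPrice (u 0) x ⬝ᵥ fun l => v (Sum.inr l)) = supportPrice (u 0) x ⬝ᵥ x) :
    ruledCoords (u 0) v (Fin.last n) = u 0 x := by
  rw [ruledCoords, Function.update_self, budget_eq_supportBudget hu h1 h2,
    Function.leftInverse_invFun (hu 0).supportBudget_injective]

/-- The equilibrium manifold has a global parametrization, ruled over the Pareto curve. -/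
theorem isLocalParam_ruledParam {X : ℝ → Fin (n + 1) → ℝ} (hX : ∀ t ∈ Set.range (u 0),
      X t ∈ paretoSet u r ∧ u 0 (X t) = t ∧ ContDiffAt ℝ (⊤ : ℕ∞) X t) :
    IsLocalParam (euclideanEquilibriumManifold u r)
      {z : Fin (n + 1) → ℝ | z (Fin.last n) ∈ Set.range (u 0)}
      (ruledParam (fun t => supportPrice (u 0) (X t)) X) ∧
    euclideanEquilibriumManifold u r ⊆ ruledParam (fun t => supportPrice (u 0) (X t)) X ''
      {z : Fin (n + 1) → ℝ | z (Fin.last n) ∈ Set.range (u 0)} := by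
  set P := fun t => supportPrice (u 0) (X t) with hPdef
  set U := {z : Fin (n + 1) → ℝ | z (Fin.last n) ∈ Set.range (u 0)}
  have hI := (hu 0).isOpen_range
  have hU : IsOpen U := hI.preimage (continuous_apply (Fin.last n))
  have hP : ∀ t ∈ Set.range (u 0), ContDiffAt ℝ (⊤ : ℕ∞) P t := fun t ht =>
    (hu 0).contDiff_supportPrice.contDiffAt.comp t (hX t ht).2.2
  have hs : ContDiffOn ℝ (⊤ : ℕ∞) (ruledParam P X) U :=
    contDiffOn_ruledParam hP fun t ht => (hX t ht).2.2
  have hinl : ∀ z, ∀ i : Fin n,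
      ruledParam P X z (Sum.inl i) = supportPrice (u 0) (X (z (Fin.last n))) i.castSucc :=
    fun z i => rfl
  have hinr : ∀ z, (supportPrice (u 0) (X (z (Fin.last n))) ⬝ᵥ
      fun l => ruledParam P X z (Sum.inr l))
      = supportPrice (u 0) (X (z (Fin.last n))) ⬝ᵥ X (z (Fin.last n)) := by
    intro z
    have h1 : (fun l => ruledParam P X z (Sum.inr l))
        = z + Pi.single (Fin.last n) (P (z (Fin.last n)) ⬝ᵥ (X (z (Fin.last n)) - z)) := rfl
    rw [h1, dotProduct_add, dotProduct_single, ((hu 0).supportPrice_mem _).2, hPdef,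
      dotProduct_sub]
    ring
  have hmaps : Set.MapsTo (ruledParam P X) U (euclideanEquilibriumManifold u r) := fun z hz =>
    (mem_euclideanEquilibriumManifold_iff hu _).2 ⟨_, (hX _ hz).1, hinl z, hinr z⟩
  have hleft : ∀ z ∈ U, ruledCoords (u 0) (ruledParam P X z) = z := by
    intro z hz
    ext l
    induction l using Fin.lastCases with
    | last => rw [ruledCoords_last hu (hinl z) (hinr z), (hX _ hz).2.1]
    | cast i =>
      rw [ruledCoords, Function.update_of_ne (Fin.castSucc_ne_last i), ruledParam_castSucc]
  have hmaps' : Set.MapsTo (ruledCoords (u 0)) (euclideanEquilibriumManifold u r) U := by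
    intro v hv
    obtain ⟨x, -, h1, h2⟩ := (mem_euclideanEquilibriumManifold_iff hu v).1 hv
    exact ⟨x, (ruledCoords_last hu h1 h2).symm⟩
  have hright : ∀ v ∈ euclideanEquilibriumManifold u r,
      ruledParam P X (ruledCoords (u 0) v) = v := by
    intro v hv
    obtain ⟨x, hx, h1, h2⟩ := (mem_euclideanEquilibriumManifold_iff hu v).1 hv
    have h3 := ruledCoords_last hu h1 h2
    have hXx : X (u 0 x) = x :=
      paretoSet_injOn hu (hX _ ⟨x, rfl⟩).1 hx (hX _ ⟨x, rfl⟩).2.1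
    ext k
    rcases k with i | l
    · rw [ruledParam_inl, h3, h1, hPdef]
      simp only [hXx]
    · induction l using Fin.lastCases with
      | last =>
        rw [ruledParam_last, h3, hPdef]
        simp only [hXx]
        rw [dotProduct_sub, ← h2, dotProduct, dotProduct, Fin.sum_univ_castSucc,
          Fin.sum_univ_castSucc, h3, ((hu 0).supportPrice_mem x).2]
        simp only [ruledCoords, Function.update_of_ne (Fin.castSucc_ne_last _)]
        ring
      | cast i =>
        rw [ruledParam_castSucc, ruledCoords, Function.update_of_ne (Fin.castSucc_ne_last i)]
  refine ⟨⟨hU, hs, fun z hz => ?_, hmaps, ?_⟩, fun v hv => ⟨_, hmaps' hv, hright v hv⟩⟩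
  · have hd := differentiableAt_of_contDiffOn hU hs hz
    have hd' := (contDiffAt_ruledCoords hu (hmaps hz)).differentiableAt (by simp)
    have h1 := hd'.hasFDerivAt.comp z hd.hasFDerivAt
    have h2 : HasFDerivAt (ruledCoords (u 0) ∘ ruledParam P X)
        (ContinuousLinearMap.id ℝ (Fin (n + 1) → ℝ)) z :=
      (hasFDerivAt_id z).congr_of_eventuallyEq
        (Filter.eventuallyEq_of_mem (hU.mem_nhds hz) hleft)
    have h3 := h1.unique h2
    -- By the chain rule the derivative of the left inverse `ruledCoords` is a left inverse of the
    -- derivative.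
    exact Function.LeftInverse.injective (g := fderiv ℝ (ruledCoords (u 0)) (ruledParam P X z))
      fun w => congrArg (fun T : (Fin (n + 1) → ℝ) →L[ℝ] (Fin (n + 1) → ℝ) => T w) h3
  · let e : U ≃ₜ euclideanEquilibriumManifold u r :=
      { toFun := hmaps.restrict
        invFun := hmaps'.restrict
        left_inv := fun z => Subtype.ext (hleft z z.2)
        right_inv := fun v => Subtype.ext (hright v v.2)
        continuous_toFun := hs.continuousOn.mapsToRestrict hmaps
        continuous_invFun := ContinuousOn.mapsToRestrict (fun v hv =>
          (contDiffAt_ruledCoords hu hv).continuousAt.continuousWithinAt) hmaps' }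
    exact e.isOpenEmbedding

end Param

end Exchange

/-! ### The equivalence -/

theorem corollary3p2 (n : ℕ) (u : Fin 2 → (Fin (n + 1) → ℝ) → ℝ)
    (hu : ∀ i, Exchange.IsSmoothUtility (u i)) (r : Fin (n + 1) → ℝ) :
    Embedded.IsSmoothSubmanifold (n + 1) (Exchange.euclideanEquilibriumManifold u r) ∧
    ((∀ ω ∈ Exchange.endowments 2 r, ∃! p, (p, ω) ∈ Exchange.equilibriumManifold u r) ↔
      Embedded.HasZeroCurvature (n + 1) (Exchange.euclideanEquilibriumManifold u r)) := by
  obtain ⟨X, hX⟩ := Exchange.exists_paretoCurve hu r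
  obtain ⟨hΦ, hsurj⟩ := Exchange.isLocalParam_ruledParam hu hX
  refine ⟨fun v hv => ⟨_, _, hΦ, hsurj hv⟩, ?_⟩
  rw [Exchange.existsUnique_iff hu]
  constructor
  · intro h
    obtain ⟨y, hy, -⟩ := Exchange.exists_mem_paretoSet hu (r := r) r
    refine Embedded.hasZeroCurvature_of_coords_const
      (q := fun i : Fin n => Exchange.supportPrice (u 0) y i.castSucc) fun v hv i => ?_
    obtain ⟨x, hx, h1, -⟩ := (Exchange.mem_euclideanEquilibriumManifold_iff hu v).1 hv
    rw [h1, h x hx y hy]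
  · intro hK x hx y hy
    have hI := (hu 0).isOpen_range
    have hXd : ∀ t ∈ Set.range (u 0), ContDiffAt ℝ (⊤ : ℕ∞) X t := fun t ht => (hX t ht).2.2
    have hP : ∀ t ∈ Set.range (u 0),
        ContDiffAt ℝ (⊤ : ℕ∞) (fun t => Exchange.supportPrice (u 0) (X t)) t := fun t ht =>
      (hu 0).contDiff_supportPrice.contDiffAt.comp t (hXd t ht)
    have hXx : ∀ x ∈ Exchange.paretoSet u r, X (u 0 x) = x := fun x hx =>
      Exchange.paretoSet_injOn hu (hX _ ⟨x, rfl⟩).1 hx (hX _ ⟨x, rfl⟩).2.1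
    refine (hu 0).supportPrice_ext fun i => ?_
    -- Any point whose last entry is `t` detects the derivative at `t`; the constant vector `t` is
    -- used.
    have hconst := hI.is_const_of_deriv_eq_zero
      (isPreconnected_range (hu 0).smooth.continuous)
      (f := fun t => Exchange.supportPrice (u 0) (X t) i.castSucc)
      (fun t ht => ((contDiffAt_pi.1 (hP t ht) i.castSucc).differentiableAt
        (by simp)).differentiableWithinAt)
      (fun t ht => Exchange.deriv_eq_zero_of_sectionalCurvature_eq_zero hI hP hXd
        (fun z hz => hΦ.immersion z hz) (z := fun _ => t) ht
        (fun a b hab => hK _ _ hΦ (fun _ => t) ht a b hab) i)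
      (x := u 0 x) (y := u 0 y) ⟨x, rfl⟩ ⟨y, rfl⟩
    simpa only [hXx x hx, hXx y hy] using hconst
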